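/- Let $\mathcal H=(\mathbb C^d)^{\otimes n}$ be the space of $n$ qudits. The symmetric group $S_n$ acts on $\mathcal H$ by permuting the qudits; let $p(n,d)$ be the number of inequivalent irreducible representations of $S_n$ occurring in $\mathcal H$, and call the corresponding isotypic components of $\mathcal H$ the charge sectors. An operator on $\mathcal H$ is $SU(d)$-symmetric if it commutes with $V^{\otimes n}$ for all $V\in SU(d)$; let $\mathcal H_\times$ be the compact group of $SU(d)$-symmetric unitaries on $\mathcal H$. A relative phase matrix is an element of $\mathcal H_\times$ that acts as a scalar on each charge sector. An element of $\mathcal H_\times$ has locality $\gamma$ if it acts nontrivially on at most $\gamma$ qudits, or if it equals $e^{-iH}$ for an $SU(d)$-symmetric Hermitian $H$ that is a sum of operators each acting on at most $\gamma$ qudits. Let $G_\gamma\subseteq\mathcal H_\times$ be the closed subgroup generated by the elements of locality $\gamma$ (all circuits of such gates, and their limits). An ensemble of locality $\gamma$ is a Borel probability measure $\nu$ on $\mathcal H_\times$ (finitely or infinitely supported) with $\nu(G_\gamma)=1$. Its $k$-fold twirling channel is $T_k^\nu(M)=\int U^{\otimes k}MU^{\dagger\otimes k}\,d\nu(U)$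 for $M\in\operatorname{End}(\mathcal H^{\otimes k})$, and $T_k^{\mathrm{Haar}}$ is the one for the Haar probability measure of $\mathcal H_\times$. After $s$ steps, $\nu$ is an $\epsilon$-approximate $SU(d)$-symmetric $k$-design if $\|(T_k^\nu)^s-T_k^{\mathrm{Haar}}\|_\diamond\le\epsilon/d^{nk}$ (diamond norm). We say that locality $\gamma$ excludes large designs on $n$ qudits if there is $k_0$ such that for every $k\ge k_0$ there is $\epsilon>0$ such that no ensemble of locality $\gamma$ is, after any number $s\ge 0$ of steps, an $\epsilon$-approximate $SU(d)$-symmetric $k$-design. 1. There is a universal constant $c>0$ such that for all $n,d,\gamma\ge 0$: (a) if $G_\gamma$ contains all relative phase matrices, then $\gamma\ge c\log p(n,d)$; (b) if $\gamma<c\log p(n,d)$, then locality $\gamma$ excludes large designs on $n$ qudits. 2. For every $d\ge 2$ and every $\gamma$ there is $n_0$ such that, for all $n\ge n_0$, locality $\gamma$ excludes large designs on $n$ qudits. That is, no ensemble of $SU(d)$-symmetric unitaries of bounded locality, finite or infinite, approximates the $SU(d)$-symmetric $k$-design for arbitrarily large $k$. -/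

import Mathlib

open MeasureTheory
open scoped ENNReal Matrix

noncomputable section

namespace SymDesign

/-- The tensor power `A^{⊗ k}` of a matrix; the basis of the `k`-fold tensor power of `ℂ^ι`
is indexed by `Fin k → ι`. -/
def tensorPow {ι : Type} (k : ℕ) (A : Matrix ι ι ℂ) :
    Matrix (Fin k → ι) (Fin k → ι) ℂ :=
  Matrix.of fun x y => ∏ i, A (x i) (y i)

/-- The computational basis of `n` qudits of local dimension `d`. -/
abbrev Idx (n d : ℕ) : Type := Fin n → Fin d

/-- `SU(d)` symmetry of an operator on `n` qudits: it commutes with `V^{⊗ n}` for all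
`V ∈ SU(d)`. -/
def IsSymmetric {n d : ℕ} (A : Matrix (Idx n d) (Idx n d) ℂ) : Prop :=
  ∀ V ∈ Matrix.specialUnitaryGroup (Fin d) ℂ, Commute A (tensorPow n V)

lemma isSymmetric_star {n d : ℕ} {A : Matrix (Idx n d) (Idx n d) ℂ} (hA : IsSymmetric A) :
    IsSymmetric (star A) := by
  intro V hV
  have hV' : star V ∈ Matrix.specialUnitaryGroup (Fin d) ℂ := by
    rw [Matrix.mem_specialUnitaryGroup_iff] at hV ⊢
    exact ⟨Unitary.star_mem hV.1, by
      rw [Matrix.star_eq_conjTranspose, Matrix.det_conjTranspose, hV.2, star_one]⟩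
  have h := (commute_star_star (x := A)).2 (hA (star V) hV')
  have e : star (tensorPow n (star V)) = tensorPow n V := by
    ext x y
    simp [tensorPow, Matrix.star_apply]
  rwa [e] at h

/-- The group of `SU(d)`-symmetric unitaries on `n` qudits. -/
def symUnitary (n d : ℕ) : Subgroup (Matrix.unitaryGroup (Idx n d) ℂ) where
  carrier := {U | IsSymmetric (U : Matrix (Idx n d) (Idx n d) ℂ)}
  one_mem' := fun _ _ => Commute.one_left _
  mul_mem' := fun {_ _} hU hW V hV => (hU V hV).mul_left (hW V hV)
  inv_mem' := fun {_} hU => isSymmetric_star hU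

/-- The compact group of `SU(d)`-symmetric unitaries, as a type. -/
abbrev SymU (n d : ℕ) : Type := ↥(symUnitary n d)

/-- The matrix of a symmetric unitary. -/
def SymU.mat {n d : ℕ} (U : SymU n d) : Matrix (Idx n d) (Idx n d) ℂ :=
  ((U : Matrix.unitaryGroup (Idx n d) ℂ) : Matrix (Idx n d) (Idx n d) ℂ)

lemma SymU.continuous_mat {n d : ℕ} : Continuous (SymU.mat : SymU n d → _) :=
  continuous_subtype_val.comp continuous_subtype_val

instance (n d : ℕ) : CompactSpace (SymU n d) := by
  have hcl : IsClosed {A : Matrix (Idx n d) (Idx n d) ℂ |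
      A ∈ Matrix.unitaryGroup (Idx n d) ℂ ∧ IsSymmetric A} := by
    have h1 : IsClosed {A : Matrix (Idx n d) (Idx n d) ℂ |
        A ∈ Matrix.unitaryGroup (Idx n d) ℂ} := isClosed_unitary
    have h2 : IsClosed {A : Matrix (Idx n d) (Idx n d) ℂ | IsSymmetric A} := by
      simp only [IsSymmetric, Commute, SemiconjBy, Set.ofPred_forall]
      exact isClosed_iInter fun V => isClosed_iInter fun _ =>
        isClosed_eq (by fun_prop) (by fun_prop)
    exact h1.inter h2
  have hK : IsCompact (Set.pi Set.univ fun _ : Idx n d => Set.pi Set.univ fun _ : Idx n d =>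
      Metric.closedBall (0 : ℂ) 1) :=
    isCompact_univ_pi fun _ => isCompact_univ_pi fun _ => isCompact_closedBall 0 1
  have hc : IsCompact {A : Matrix (Idx n d) (Idx n d) ℂ |
      A ∈ Matrix.unitaryGroup (Idx n d) ℂ ∧ IsSymmetric A} := by
    refine hK.of_isClosed_subset hcl ?_
    rintro A ⟨hA, -⟩ i - j -
    simpa using entry_norm_bound_of_unitary hA i j
  have hind : Topology.IsInducing (SymU.mat : SymU n d → _) :=
    Topology.IsInducing.subtypeVal.comp Topology.IsInducing.subtypeVal
  refine ⟨hind.isCompact_iff.2 ?_⟩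
  convert hc
  ext A
  constructor
  · rintro ⟨U, -, rfl⟩
    exact ⟨U.1.2, U.2⟩
  · rintro ⟨h1, h2⟩
    exact ⟨⟨⟨A, h1⟩, h2⟩, trivial, rfl⟩

instance (n d : ℕ) : MeasurableSpace (SymU n d) := borel _

instance (n d : ℕ) : BorelSpace (SymU n d) := ⟨rfl⟩

/-- The Haar probability measure on the group of symmetric unitaries. -/
def haarSym (n d : ℕ) : Measure (SymU n d) := Measure.haarMeasure ⊤

instance (n d : ℕ) : IsProbabilityMeasure (haarSym n d) :=
  ⟨by simpa [haarSym] using Measure.haarMeasure_self (G := SymU n d) (K₀ := ⊤)⟩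

/-! ### Twirling channels, diamond norm, approximate designs -/

/-- The integrand `U^{⊗ k} M (U^{⊗ k})†` of the `k`-fold twirling channel. -/
def conjPow {n d : ℕ} (k : ℕ) (U : SymU n d)
    (M : Matrix (Fin k → Idx n d) (Fin k → Idx n d) ℂ) :
    Matrix (Fin k → Idx n d) (Fin k → Idx n d) ℂ :=
  tensorPow k U.mat * M * (tensorPow k U.mat)ᴴ

lemma integrable_conjPow {n d : ℕ} (ν : Measure (SymU n d)) [IsFiniteMeasure ν] (k : ℕ)
    (M : Matrix (Fin k → Idx n d) (Fin k → Idx n d) ℂ) (x y : Fin k → Idx n d) :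
    Integrable (fun U => conjPow k U M x y) ν := by
  have hT : Continuous fun U : SymU n d => tensorPow k U.mat := by
    refine continuous_matrix fun a b => ?_
    simp only [tensorPow, Matrix.of_apply]
    exact continuous_finsetProd _ fun i _ => SymU.continuous_mat.matrix_elem _ _
  have hc : Continuous fun U : SymU n d => conjPow k U M x y := by
    refine Continuous.matrix_elem ?_ x y
    unfold conjPow
    exact (hT.mul continuous_const).mul hT.matrix_conjTranspose
  simpa using hc.continuousOn.integrableOn_compact (μ := ν) isCompact_univ

/-- The `k`-fold twirling channel `M ↦ ∫ U^{⊗ k} M (U^{⊗ k})† dν(U)` (entrywise integral). -/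
def twirl {n d : ℕ} (ν : Measure (SymU n d)) [IsFiniteMeasure ν] (k : ℕ) :
    Module.End ℂ (Matrix (Fin k → Idx n d) (Fin k → Idx n d) ℂ) where
  toFun M := Matrix.of fun x y => ∫ U, conjPow k U M x y ∂ν
  map_add' M N := by
    ext x y
    have h : ∀ U, conjPow k U (M + N) x y = conjPow k U M x y + conjPow k U N x y := by
      intro U
      simp [conjPow, mul_add, add_mul]
    simp only [Matrix.of_apply, Matrix.add_apply, h]
    exact integral_add (integrable_conjPow ν k M x y) (integrable_conjPow ν k N x y)
  map_smul' c M := by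
    ext x y
    have h : ∀ U, conjPow k U (c • M) x y = c • conjPow k U M x y := by
      intro U
      simp [conjPow]
    simp only [Matrix.of_apply, Matrix.smul_apply, RingHom.id_apply, h]
    exact integral_smul c _

/-- The trace norm `tr √(A† A)`: the sum of the singular values. -/
def traceNorm {ι : Type} [Fintype ι] [DecidableEq ι] (A : Matrix ι ι ℂ) : ℝ :=
  ∑ i, √((Matrix.isHermitian_conjTranspose_mul_self A).eigenvalues i)

/-- `Φ ⊗ id_r`, where the second tensor factor is an ancilla of dimension `r`. -/
def ampliation {ι : Type} (Φ : Module.End ℂ (Matrix ι ι ℂ)) (r : ℕ)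
    (X : Matrix (ι × Fin r) (ι × Fin r) ℂ) : Matrix (ι × Fin r) (ι × Fin r) ℂ :=
  Matrix.of fun p q => Φ (Matrix.of fun x y => X (x, p.2) (y, q.2)) p.1 q.1

/-- The diamond norm of a superoperator, as a supremum in `[0, ∞]`. -/
def diamondNorm {ι : Type} [Fintype ι] [DecidableEq ι] (Φ : Module.End ℂ (Matrix ι ι ℂ)) :
    ℝ≥0∞ :=
  ⨆ (r : ℕ) (X : Matrix (ι × Fin r) (ι × Fin r) ℂ) (_ : traceNorm X ≤ 1),
    ENNReal.ofReal (traceNorm (ampliation Φ r X))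

/-- The random circuit that applies `s` independent samples from the ensemble `ν` is an
`ε`-approximate `SU(d)`-symmetric `k`-design. -/
def IsApproxDesign {n d : ℕ} (ν : Measure (SymU n d)) [IsFiniteMeasure ν] (s k : ℕ) (ε : ℝ) :
    Prop :=
  diamondNorm (twirl ν k ^ s - twirl (haarSym n d) k) ≤
    ENNReal.ofReal (ε / ((d : ℝ) ^ n) ^ k)

/-! ### Locality -/

/-- `A` acts only on the qudits in `S`: `A = B_S ⊗ 1` on the other qudits. -/
def ActsOn {n d : ℕ} (S : Finset (Fin n)) (A : Matrix (Idx n d) (Idx n d) ℂ) : Prop :=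
  ∃ B : Matrix (S → Fin d) (S → Fin d) ℂ, ∀ x y,
    A x y = if ∀ i, i ∉ S → x i = y i then B (fun i => x i) (fun i => y i) else 0

/-- Operators acting on at most `γ` qudits. -/
def IsLocal {n d : ℕ} (γ : ℕ) (A : Matrix (Idx n d) (Idx n d) ℂ) : Prop :=
  ∃ S : Finset (Fin n), S.card ≤ γ ∧ ActsOn S A

/-- `SU(d)`-symmetric `γ`-local Hamiltonians: Hermitian symmetric sums of operators each of
which acts on at most `γ` qudits. -/
def IsLocalHamiltonian {n d : ℕ} (γ : ℕ) (H : Matrix (Idx n d) (Idx n d) ℂ) : Prop :=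
  H.IsHermitian ∧ IsSymmetric H ∧ H ∈ Submodule.span ℂ {A | IsLocal γ A}

/-- `SU(d)`-symmetric unitaries of locality `γ`: those acting on at most `γ` qudits, and the time
evolutions of `SU(d)`-symmetric `γ`-local Hamiltonians. -/
def localGates (n d γ : ℕ) : Set (SymU n d) :=
  {U | IsLocal γ U.mat ∨
    ∃ H, IsLocalHamiltonian γ H ∧ U.mat = NormedSpace.exp ((-Complex.I) • H)}

/-- The closed group generated by the symmetric unitaries of locality `γ`: all circuits of such
gates and their limits. -/
def localGroup (n d γ : ℕ) : Subgroup (SymU n d) :=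
  (Subgroup.closure (localGates n d γ)).topologicalClosure

/-! ### Charge sectors and relative phases -/

/-- The action of `S_n` on `n` qudits, `σ |i_1, …, i_n⟩ = |i_{σ⁻¹(1)}, …, i_{σ⁻¹(n)}⟩`. -/
def permRep (n d : ℕ) : Representation ℂ (Equiv.Perm (Fin n)) (Idx n d → ℂ) where
  toFun σ :=
    { toFun := fun f x => f (x ∘ σ)
      map_add' := fun _ _ => rfl
      map_smul' := fun _ _ => rfl }
  map_one' := rfl
  map_mul' _ _ := rfl

/-- The charge sectors: the isotypic components (an `S_n` irrep together with all its copies) of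
the `n`-qudit space. -/
def sectors (n d : ℕ) :
    Set (Submodule (MonoidAlgebra ℂ (Equiv.Perm (Fin n))) (permRep n d).asModule) :=
  isotypicComponents (MonoidAlgebra ℂ (Equiv.Perm (Fin n))) (permRep n d).asModule

/-- `p(n,d)`, the number of inequivalent `S_n` irreps in the space of `n` qudits. -/
def numSectors (n d : ℕ) : ℕ := (sectors n d).ncard

/-- Relative phase matrices: unitaries that act as a scalar on each charge sector. -/
def IsRelativePhase {n d : ℕ} (U : SymU n d) : Prop :=
  ∀ C ∈ sectors n d, ∃ z : ℂ, ∀ v ∈ C,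
    U.mat *ᵥ (permRep n d).asModuleEquiv v = z • (permRep n d).asModuleEquiv v

/-- For all large `k`, ensembles (probability measures) of unitaries from `localGroup n d γ`
stay at a fixed distance from the `SU(d)`-symmetric `k`-design, however many steps are taken. -/
def NoLargeDesigns (n d γ : ℕ) : Prop :=
  ∃ k₀ : ℕ, ∀ k ≥ k₀, ∃ ε > (0 : ℝ), ∀ (ν : Measure (SymU n d)) [IsProbabilityMeasure ν],
    (∀ᵐ U ∂ν, U ∈ localGroup n d γ) → ∀ s : ℕ, ¬ IsApproxDesign ν s k ε

end SymDesign

end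

open SymDesign

noncomputable section

namespace SymDesign

/-! ### Words up to renaming of letters and positions -/

/-! A nontrivial character of the symmetric unitaries that is trivial on all local gates obstructs
both conclusions. Commuting with diagonal phases forces a symmetric operator to preserve letter
counts, so it is block diagonal along word classes (words up to renaming letters and permuting
positions). The block determinants are characters; weighting them by integers `m` gives `weightHom
m`, and on `e^{-iH}` its value is `exp(-i ∑ m(cls x) H x x)`.

Triviality on local gates: the diagonal of a `γ`-local `H` is a sum of functions of at most `γ`
letters, so it is enough that the marginals of `m` on `γ` positions vanish. By symmetry these are
only as many integer equations as there are word classes of length `γ`, at most `2 ^ γ`. If length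
`n` has more classes, a nonzero solution exists (`exists_weight`). A gate acting on few qudits is
handled through its Hermitian logarithm (`weightHom_eq_one_of_actsOn`).

Nontriviality: class sums of permutations generate relative phases, and their weighted trace counts
words fixed by a permutation. A suitable permutation makes this count nonzero
(`exists_perm_sum_fixed_ne_zero`).

Designs: since `m` has total weight zero, the character is a matrix coefficient of `U^{⊗ k} ⊗ Ū^{⊗
k}` for all large `k`. Hence some matrix `M ≠ 0` is multiplied by the character under conjugation.
Every local twirl fixes `M` and the Haar twirl kills it, so their diamond distance stays bounded
below (`noLargeDesigns_of_character`).

Finally, an operator that is scalar on sectors is determined by its diagonal, which is constant on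
word classes. So `p(n,d)` is at most the number of classes (`numSectors_le`), and the constant `1`
works. For `d ≥ 2` the number of classes is unbounded in `n` (`le_card_wordClass`), which gives the
second part. -/

lemma exists_perm_comp_eq {α β : Type*} [Fintype α] [DecidableEq β] (f g : α → β)
    (h : ∀ b, Fintype.card {a // f a = b} = Fintype.card {a // g a = b}) :
    ∃ σ : Equiv.Perm α, g ∘ σ = f :=
  ⟨Equiv.ofFiberEquiv fun b => Fintype.equivOfCardEq (h b),
    funext fun a => Equiv.ofFiberEquiv_map _ a⟩

/-- Two words are equivalent if they differ by permutations of the alphabet and of the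
positions. -/
def wordSetoid (n d : ℕ) : Setoid (Idx n d) where
  r x y := ∃ (π : Equiv.Perm (Fin d)) (σ : Equiv.Perm (Fin n)), y = π ∘ x ∘ σ
  iseqv :=
    { refl := fun _ => ⟨1, 1, rfl⟩
      symm := by
        rintro x y ⟨π, σ, rfl⟩
        exact ⟨π⁻¹, σ⁻¹, by ext i; simp⟩
      trans := by
        rintro x y z ⟨π, σ, rfl⟩ ⟨π', σ', rfl⟩
        exact ⟨π' * π, σ * σ', rfl⟩ }

/-- Words of length `n` over `d` letters up to equivalence. -/
def WordClass (n d : ℕ) : Type := Quotient (wordSetoid n d)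

/-- The class of a word. -/
def cls {n d : ℕ} (x : Idx n d) : WordClass n d := Quotient.mk (wordSetoid n d) x

instance (n d : ℕ) : Finite (WordClass n d) := Quotient.finite _

instance (n d : ℕ) : Fintype (WordClass n d) := Fintype.ofFinite _

instance (n d : ℕ) : DecidableEq (WordClass n d) := Classical.decEq _

lemma cls_eq_cls {n d : ℕ} {x y : Idx n d} :
    cls x = cls y ↔ ∃ (π : Equiv.Perm (Fin d)) (σ : Equiv.Perm (Fin n)), y = π ∘ x ∘ σ :=
  Quotient.eq (r := wordSetoid n d)

lemma cls_comp {n d : ℕ} (x : Idx n d) (π : Equiv.Perm (Fin d)) (σ : Equiv.Perm (Fin n)) :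
    cls (π ∘ x ∘ σ) = cls x :=
  (cls_eq_cls.2 ⟨π, σ, rfl⟩).symm

lemma cls_surjective {n d : ℕ} (c : WordClass n d) : ∃ x : Idx n d, cls x = c :=
  Quotient.exists_rep c

/-- The number of occurrences of a letter in a word. -/
def letterCount {n d : ℕ} (x : Idx n d) (j : Fin d) : ℕ := Fintype.card {i // x i = j}

lemma sum_letterCount {n d : ℕ} (x : Idx n d) : ∑ j, letterCount x j = n := by
  have := Fintype.card_congr (Equiv.sigmaFiberEquiv x)
  simpa [Fintype.card_sigma, letterCount] using this

lemma letterCount_comp {n d : ℕ} (x : Idx n d) (π : Equiv.Perm (Fin d))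
    (σ : Equiv.Perm (Fin n)) (j : Fin d) :
    letterCount (π ∘ x ∘ σ) j = letterCount x (π.symm j) := by
  refine Fintype.card_congr (σ.subtypeEquiv fun i => ?_)
  simp [Equiv.eq_symm_apply]

lemma cls_eq_of_letterCount {n d : ℕ} {x y : Idx n d} (h : letterCount x = letterCount y) :
    cls x = cls y := by
  obtain ⟨σ, hσ⟩ := exists_perm_comp_eq y x fun j => (congrFun h j).symm
  exact cls_eq_cls.2 ⟨1, σ, hσ.symm⟩

/-- The partition of `n` into the numbers of occurrences of the letters. -/
def wordPartition {n d : ℕ} (x : Idx n d) : n.Partition :=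
  Nat.Partition.ofSums n (Finset.univ.val.map (letterCount x)) (sum_letterCount x)

/-- The partition forgets zero parts, so the number of unused letters is recovered as `d` minus the
number of letters with positive count. -/
lemma card_letterCount_eq {n d : ℕ} {x y : Idx n d} (h : wordPartition x = wordPartition y)
    (k : ℕ) : Fintype.card {j // letterCount x j = k} =
      Fintype.card {j // letterCount y j = k} := by
  have key : ∀ k ≠ 0, Fintype.card {j // letterCount x j = k} =
      Fintype.card {j // letterCount y j = k} := by
    intro k hk
    have h1 := congrArg (fun p => Multiset.count k p.parts) h
    simp only [wordPartition, Nat.Partition.ofSums] at h1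
    rw [Multiset.count_filter_of_pos (p := (· ≠ 0)) hk,
      Multiset.count_filter_of_pos (p := (· ≠ 0)) hk] at h1
    simp only [Multiset.count_map, Fintype.card_subtype] at h1 ⊢
    simpa [Finset.card_def, Finset.filter_val, eq_comm] using h1
  rcases eq_or_ne k 0 with rfl | hk
  · have hx := Fintype.card_subtype_compl fun j => letterCount x j = 0
    have hy := Fintype.card_subtype_compl fun j => letterCount y j = 0
    have hle := Fintype.card_subtype_le fun j => letterCount x j = 0
    have hle' := Fintype.card_subtype_le fun j => letterCount y j = 0
    have : Fintype.card {j // ¬ letterCount x j = 0} =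
        Fintype.card {j // ¬ letterCount y j = 0} := by
      have e : ∀ z : Idx n d, Fintype.card {j // ¬ letterCount z j = 0} =
          ∑ k ∈ Finset.Icc 1 n, Fintype.card {j // letterCount z j = k} := by
        intro z
        simp only [Fintype.card_subtype]
        rw [Finset.card_eq_sum_card_fiberwise (f := letterCount z) (t := Finset.Icc 1 n)]
        · refine Finset.sum_congr rfl fun k hk => ?_
          congr 1
          ext j
          have := (Finset.mem_Icc.1 hk).1
          simp only [Finset.mem_filter, Finset.mem_univ, true_and, and_iff_right_iff_imp]
          omega
        · intro j hj
          have h1 : letterCount z j ≠ 0 := by simpa using hj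
          have h2 : letterCount z j ≤ n := by
            simpa [letterCount] using Fintype.card_subtype_le fun i => z i = j
          simp only [Finset.coe_Icc, Set.mem_Icc]
          omega
      rw [e, e]
      refine Finset.sum_congr rfl fun k hk => key k ?_
      have := (Finset.mem_Icc.1 hk).1
      omega
    omega
  · exact key k hk

lemma cls_eq_of_wordPartition {n d : ℕ} {x y : Idx n d}
    (h : wordPartition x = wordPartition y) : cls x = cls y := by
  obtain ⟨π, hπ⟩ := exists_perm_comp_eq (letterCount x) (letterCount y) (card_letterCount_eq h)
  have h1 : letterCount x = letterCount (π.symm ∘ y ∘ (1 : Equiv.Perm (Fin n))) := by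
    ext j
    rw [letterCount_comp, Equiv.symm_symm, ← hπ, Function.comp_apply]
  rw [cls_eq_of_letterCount h1, cls_comp]

/-- A class is determined by its partition of `n`, and every partition comes from one of the `2 ^ (n
- 1)` compositions. -/
lemma card_wordClass_le (n d : ℕ) : Fintype.card (WordClass n d) ≤ 2 ^ n := by
  have h1 : Fintype.card (WordClass n d) ≤ Fintype.card n.Partition := by
    choose r hr using cls_surjective (n := n) (d := d)
    refine Fintype.card_le_of_injective (fun c => wordPartition (r c)) fun a b hab => ?_
    rw [← hr a, ← hr b]
    exact cls_eq_of_wordPartition hab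
  have h2 : Fintype.card n.Partition ≤ 2 ^ (n - 1) := by
    rw [← composition_card n]
    exact Fintype.card_le_of_surjective _ Nat.Partition.ofComposition_surj
  exact h1.trans (h2.trans (Nat.pow_le_pow_right two_pos (Nat.sub_le _ _)))

lemma le_card_wordClass {n d a : ℕ} (hd : 2 ≤ d) (hn : 2 * a + 1 ≤ n) :
    a ≤ Fintype.card (WordClass n d) := by
  -- Words with `k + 1 ≤ a` zeros and otherwise ones. The ones number more than `a` because `n ≥ 2 *
  -- a + 1`, so `k + 1` is the only count in `[1, a]` and survives renaming of letters.
  let w : Fin a → Idx n d := fun k i =>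
    if (i : ℕ) ≤ k then ⟨0, by omega⟩ else ⟨1, by omega⟩
  have h0 : ∀ k : Fin a, letterCount (w k) ⟨0, by omega⟩ = k + 1 := by
    intro k
    have : letterCount (w k) ⟨0, by omega⟩ = (Finset.univ.filter
        fun i : Fin n => (i : ℕ) < k + 1).card := by
      rw [letterCount, Fintype.card_subtype]
      congr 1
      ext i
      by_cases hi : (i : ℕ) ≤ k <;> simp [w, hi]
    rw [this, Fin.card_filter_val_lt]
    omega
  have h1 : ∀ k : Fin a, ∀ j, letterCount (w k) j = k + 1 ∨ letterCount (w k) j = 0 ∨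
      a < letterCount (w k) j := by
    intro k j
    have hs := sum_letterCount (w k)
    by_cases hj0 : j = ⟨0, by omega⟩
    · left; rw [hj0, h0]
    by_cases hj1 : j = ⟨1, by omega⟩
    · right; right
      rw [← Finset.sum_subset (Finset.subset_univ {⟨0, by omega⟩, ⟨1, by omega⟩})] at hs
      · rw [Finset.sum_pair (by simp), h0, ← hj1] at hs
        omega
      · intro l _ hl
        simp only [Finset.mem_insert, Finset.mem_singleton, not_or] at hl
        refine Fintype.card_eq_zero_iff.2 ⟨fun i => ?_⟩
        have := i.2
        by_cases hi : (i.1 : ℕ) ≤ k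
        · simp only [w, hi, if_true] at this; exact hl.1 this.symm
        · simp only [w, hi, if_false] at this; exact hl.2 this.symm
    · right; left
      refine Fintype.card_eq_zero_iff.2 ⟨fun i => ?_⟩
      have := i.2
      by_cases hi : (i.1 : ℕ) ≤ k
      · simp only [w, hi, if_true] at this; exact hj0 this.symm
      · simp only [w, hi, if_false] at this; exact hj1 this.symm
  have hinj : Function.Injective fun k => cls (w k) := by
    intro k l hkl
    obtain ⟨π, σ, h⟩ := cls_eq_cls.1 hkl
    have := h0 l
    rw [h, letterCount_comp] at this
    have := h1 k (π.symm ⟨0, by omega⟩)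
    ext
    omega
  simpa using Fintype.card_le_of_injective _ hinj

/-! ### Integer weights on word classes -/

lemma exists_perm_comp_embedding {γ n : ℕ} (ι ι' : Fin γ ↪ Fin n) :
    ∃ σ : Equiv.Perm (Fin n), ∀ i, σ (ι i) = ι' i := by
  classical
  let e : {a // a ∈ Set.range ι} ≃ {a // a ∈ Set.range ι'} :=
    (Equiv.ofInjective ι ι.injective).symm.trans (Equiv.ofInjective ι' ι'.injective)
  refine ⟨e.extendSubtype, fun i => ?_⟩
  rw [Equiv.extendSubtype_apply_of_mem e _ ⟨i, rfl⟩]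
  simp only [e, Equiv.trans_apply]
  rw [Equiv.ofInjective_symm_apply]
  rfl

/-- The marginal of `m ∘ cls` at `w` depends on neither the embedding nor the representative of `cls
w`, which leaves one equation per class of length `γ`. The solution must be integral because it
supplies exponents of determinants. -/
lemma exists_weight {n d γ : ℕ} (hγ : γ ≤ n)
    (h : Fintype.card (WordClass γ d) < Fintype.card (WordClass n d)) :
    ∃ m : WordClass n d → ℤ, m ≠ 0 ∧ ∀ (ι : Fin γ ↪ Fin n) (b : Idx γ d → ℂ),
      ∑ x : Idx n d, (m (cls x) : ℂ) * b (x ∘ ι) = 0 := by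
  choose r hr using cls_surjective (n := γ) (d := d)
  let ι₀ : Fin γ ↪ Fin n := (Fin.castLEEmb hγ)
  let L : (WordClass n d → ℤ) →ₗ[ℤ] (WordClass γ d → ℤ) :=
    LinearMap.pi fun κ => ∑ x : Idx n d, if x ∘ ι₀ = r κ then LinearMap.proj (cls x) else 0
  have hL : ∀ m κ, L m κ = ∑ x : Idx n d, if x ∘ ι₀ = r κ then m (cls x) else 0 := by
    intro m κ
    simp only [L, LinearMap.pi_apply, LinearMap.sum_apply]
    refine Finset.sum_congr rfl fun x _ => ?_
    split_ifs <;> simp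
  have hni : ¬ Function.Injective L := fun hi => absurd (card_le_of_injective ℤ L hi) (not_le.2 h)
  rw [← LinearMap.ker_eq_bot, Submodule.eq_bot_iff] at hni
  push Not at hni
  obtain ⟨m, hm, hm0⟩ := hni
  refine ⟨m, hm0, fun ι b => ?_⟩
  have key : ∀ w : Idx γ d, ∑ x : Idx n d, (if x ∘ ι = w then m (cls x) else 0) = 0 := by
    intro w
    obtain ⟨π, τ, hw⟩ := cls_eq_cls.1 (hr (cls w))
    -- Relabelling words by `x ↦ π⁻¹ ∘ x ∘ σ` keeps their class and carries the condition at `(ι,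
    -- w)` to the one at the reference embedding and representative.
    obtain ⟨σ, hσ⟩ := exists_perm_comp_embedding ι₀ (τ.symm.toEmbedding.trans ι)
    have := hL m (cls w)
    rw [LinearMap.mem_ker.1 hm] at this
    rw [Pi.zero_apply] at this
    refine Eq.trans ?_ this.symm
    refine Fintype.sum_equiv
      ((Equiv.arrowCongr σ (Equiv.refl (Fin d))).symm.trans
        (Equiv.arrowCongr (Equiv.refl (Fin n)) π.symm)) _ _ fun x => ?_
    have e : ((Equiv.arrowCongr σ (Equiv.refl (Fin d))).symm.trans
        (Equiv.arrowCongr (Equiv.refl (Fin n)) π.symm)) x = π.symm ∘ x ∘ σ := rfl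
    rw [e, cls_comp]
    have : x ∘ ι = w ↔ (π.symm ∘ x ∘ σ) ∘ ι₀ = r (cls w) := by
      conv_lhs => rw [hw]
      constructor
      · intro hx
        ext i
        have h1 := congrFun hx (τ.symm i)
        have h2 : σ (ι₀ i) = ι (τ.symm i) := hσ i
        simp only [Function.comp_apply, Equiv.apply_symm_apply] at h1
        simp [h2, h1]
      · intro hx
        ext i
        have h1 := congrFun hx (τ i)
        have h2 : σ (ι₀ (τ i)) = ι (τ.symm (τ i)) := hσ (τ i)
        simp only [Function.comp_apply, h2, Equiv.symm_apply_apply] at h1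
        simp [← h1]
    simp only [this]
  have : ∀ x : Idx n d, (m (cls x) : ℂ) * b (x ∘ ι) =
      ∑ w, b w * ((if x ∘ ι = w then m (cls x) else 0 : ℤ) : ℂ) := by
    intro x
    rw [Finset.sum_eq_single (x ∘ ι)]
    · simp [mul_comm]
    · intro w _ hw
      simp [hw.symm]
    · simp
  simp only [this]
  rw [Finset.sum_comm]
  refine Finset.sum_eq_zero fun w _ => ?_
  rw [← Finset.mul_sum, ← Int.cast_sum, key]
  simp

/-! ### A permutation whose fixed words detect a weight -/

/-- Take `σ` to be a single cycle on each fibre of `x`; invariance under `σ` then means being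
constant on these fibres. -/
lemma exists_perm_fixed_iff_factor {α β : Type*} [Finite α] (x : α → β) :
    ∃ σ : Equiv.Perm α, x ∘ σ = x ∧ ∀ {δ : Type} (y : α → δ), y ∘ σ = y →
      ∀ a b, x a = x b → y a = y b := by
  classical
  have : ∀ c : β, ∃ τ : Equiv.Perm {a // x a = c}, ∀ a b, τ.SameCycle a b := by
    intro c
    obtain ⟨τ, hτ, -⟩ := (Set.countable_univ (α := {a // x a = c})).exists_cycleOn
    exact ⟨τ, fun a b => hτ.2 (Set.mem_univ a) (Set.mem_univ b)⟩
  choose τ hτ using this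
  have hval : ∀ c (a : {a // x a = c}), Equiv.ofFiberEquiv τ a.1 = (τ c a : α) := by
    rintro c ⟨a, rfl⟩
    rfl
  refine ⟨Equiv.ofFiberEquiv τ, funext fun a => Equiv.ofFiberEquiv_map τ a, ?_⟩
  intro δ y hy a b hab
  obtain ⟨k, hk⟩ := hτ (x b) ⟨a, hab⟩ ⟨b, rfl⟩
  have h1 : ∀ e : {a // x a = x b}, y (τ (x b) e) = y e := fun e => by
    rw [← hval]
    exact congrFun hy e.1
  have h2 : ∀ (k : ℤ) (e : {a // x a = x b}), y ((τ (x b) ^ k) e : _) = y e := by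
    intro k
    induction k with
    | zero => intro e; rfl
    | succ k ih => intro e; rw [zpow_add_one, Equiv.Perm.mul_apply, ih, h1]
    | pred k ih =>
      intro e
      rw [zpow_sub_one, Equiv.Perm.mul_apply, ih, ← h1, ← Equiv.Perm.mul_apply, mul_inv_cancel,
        Equiv.Perm.one_apply]
  have := h2 k ⟨a, hab⟩
  rw [hk] at this
  exact this.symm

/-- Choose `x` in the support of `m` with the fewest distinct letters, and `σ` cycling its level
sets. A fixed word is `g ∘ x`; if it lies in the support, minimality makes `g` injective on the
letters of `x`, so the word is in the class of `x`. All nonzero terms are thus equal and cannot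
cancel. -/
lemma exists_perm_sum_fixed_ne_zero {n d : ℕ} {m : WordClass n d → ℤ} (hm : m ≠ 0) :
    ∃ σ : Equiv.Perm (Fin n),
      (∑ x : Idx n d, if x ∘ σ = x then m (cls x) else 0) ≠ 0 := by
  classical
  obtain ⟨c₀, hc₀⟩ := Function.ne_iff.1 hm
  obtain ⟨x₀, rfl⟩ := cls_surjective c₀
  obtain ⟨x, hx, hmin⟩ := Finset.exists_min_image
    (Finset.univ.filter fun x : Idx n d => m (cls x) ≠ 0)
    (fun x => (Finset.univ.image x).card) ⟨x₀, by simpa using hc₀⟩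
  obtain ⟨σ, hσx, hσ⟩ := exists_perm_fixed_iff_factor x
  have hx0 : m (cls x) ≠ 0 := by simpa using hx
  have key : ∀ y : Idx n d, y ∘ σ = y → m (cls y) ≠ 0 → cls y = cls x := by
    intro y hy hmy
    have hle := hmin y (by simpa using hmy)
    have hf := hσ y hy
    let g : Fin d → Fin d := fun c => if h : ∃ i, x i = c then y h.choose else c
    have hg : ∀ i, g (x i) = y i := by
      intro i
      have h : ∃ i', x i' = x i := ⟨i, rfl⟩
      simp only [g, h, dif_pos]
      exact hf _ _ h.choose_spec
    have himg : (Finset.univ.image x).image g = Finset.univ.image y := by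
      rw [Finset.image_image]
      congr 1
      funext i
      exact hg i
    have hinj : Set.InjOn g (Finset.univ.image x : Finset (Fin d)) := by
      rw [← Finset.card_image_iff, himg]
      refine le_antisymm ?_ hle
      rw [← himg]
      exact Finset.card_image_le
    let e : {c // c ∈ Set.range x} ≃ {c // c ∈ Set.range y} :=
      Equiv.ofBijective (fun c => ⟨g c.1, by obtain ⟨c, i, rfl⟩ := c; exact ⟨i, (hg i).symm⟩⟩) <| by
        constructor
        · rintro ⟨_, i, rfl⟩ ⟨_, j, rfl⟩ h
          exact Subtype.ext (hinj (by simp) (by simp) (congrArg Subtype.val h))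
        · rintro ⟨_, i, rfl⟩
          exact ⟨⟨x i, i, rfl⟩, Subtype.ext (hg i)⟩
    refine (cls_eq_cls.2 ⟨e.extendSubtype, 1, ?_⟩).symm
    funext i
    simp only [Function.comp_apply, Equiv.Perm.one_apply]
    rw [Equiv.extendSubtype_apply_of_mem e _ ⟨i, rfl⟩]
    exact (hg i).symm
  refine ⟨σ, ?_⟩
  have e : (∑ y : Idx n d, if y ∘ σ = y then m (cls y) else 0) =
      ∑ y : Idx n d, if y ∘ σ = y ∧ cls y = cls x then m (cls x) else 0 := by
    refine Finset.sum_congr rfl fun y _ => ?_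
    by_cases h1 : y ∘ σ = y
    · by_cases h2 : m (cls y) = 0
      · have : cls y ≠ cls x := fun h => hx0 (h ▸ h2)
        simp [h2, this]
      · have := key y h1 h2
        simp [h1, this]
    · simp [h1]
  rw [e, ← Finset.sum_filter, Finset.sum_const, nsmul_eq_mul]
  refine mul_ne_zero ?_ hx0
  rw [Nat.cast_ne_zero, Finset.card_ne_zero]
  exact ⟨x, by simp [hσx]⟩

/-! ### Symmetric operators preserve word classes -/

lemma tensorPow_diagonal {d : ℕ} (n : ℕ) (v : Fin d → ℂ) :
    tensorPow n (Matrix.diagonal v) = Matrix.diagonal fun x : Idx n d => ∏ i, v (x i) := by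
  ext a b
  rw [tensorPow, Matrix.of_apply, Matrix.diagonal_apply]
  split_ifs with hab
  · simp [hab]
  · obtain ⟨i, hi⟩ := Function.ne_iff.1 hab
    exact Finset.prod_eq_zero (Finset.mem_univ i) (Matrix.diagonal_apply_ne _ hi)

lemma IsSymmetric.mul_prod_eq {n d : ℕ} {A : Matrix (Idx n d) (Idx n d) ℂ} (hA : IsSymmetric A)
    (v : Fin d → ℂ) (hv : ∀ j, ‖v j‖ = 1) (x y : Idx n d) :
    A x y * ∏ i, v (y i) = (∏ i, v (x i)) * A x y := by
  -- A common phase brings the determinant to `1`; it contributes the same factor `ζ ^ n` to both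
  -- sides and cancels.
  obtain ⟨ζ, hζ, hζv⟩ : ∃ ζ : ℂ, ‖ζ‖ = 1 ∧ ∏ j, ζ * v j = 1 := by
    rcases Nat.eq_zero_or_pos d with rfl | hd
    · exact ⟨1, by simp, by simp⟩
    · obtain ⟨ζ, hζ⟩ := IsAlgClosed.exists_pow_nat_eq ((∏ j, v j)⁻¹) hd
      have hp : ‖∏ j, v j‖ = 1 := by simp [norm_prod, hv]
      refine ⟨ζ, ?_, ?_⟩
      · rw [← pow_eq_one_iff_of_nonneg (norm_nonneg _) hd.ne', ← norm_pow, hζ, norm_inv, hp,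
          inv_one]
      · rw [Finset.prod_mul_distrib, Finset.prod_const, Finset.card_univ, Fintype.card_fin, hζ]
        exact inv_mul_cancel₀ (norm_ne_zero_iff.1 (by rw [hp]; exact one_ne_zero))
  have hV : Matrix.diagonal (fun j => ζ * v j) ∈ Matrix.specialUnitaryGroup (Fin d) ℂ := by
    rw [Matrix.mem_specialUnitaryGroup_iff, Matrix.mem_unitaryGroup_iff,
      Matrix.star_eq_conjTranspose, Matrix.diagonal_conjTranspose, Matrix.diagonal_mul_diagonal,
      Matrix.det_diagonal]
    refine ⟨?_, hζv⟩
    rw [← Matrix.diagonal_one]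
    congr 1
    funext j
    have : ‖ζ * v j‖ = 1 := by rw [norm_mul, hζ, hv, one_mul]
    simp only [Pi.star_apply, RCLike.star_def, Complex.mul_conj, Complex.normSq_eq_norm_sq, this]
    simp
  have h := congrFun (congrFun (hA _ hV).eq x) y
  rw [tensorPow_diagonal, Matrix.mul_diagonal, Matrix.diagonal_mul] at h
  simp only [Finset.prod_mul_distrib, Finset.prod_const] at h
  have hζ0 : ζ ^ (Finset.univ : Finset (Fin n)).card ≠ 0 :=
    pow_ne_zero _ (norm_ne_zero_iff.1 (by rw [hζ]; exact one_ne_zero))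
  refine mul_left_cancel₀ hζ0 ?_
  linear_combination h

lemma IsSymmetric.apply_eq_zero {n d : ℕ} {A : Matrix (Idx n d) (Idx n d) ℂ}
    (hA : IsSymmetric A) {x y : Idx n d} (hxy : cls x ≠ cls y) : A x y = 0 := by
  by_contra h0
  refine hxy (cls_eq_of_letterCount (funext fun j => ?_))
  -- Letter counts lie in `0, …, n`, so powers of a primitive root of order `n + 1` separate them.
  have hw := Complex.isPrimitiveRoot_exp (n + 1) n.succ_ne_zero
  set w := Complex.exp (2 * Real.pi * Complex.I / ((n + 1 : ℕ) : ℂ))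
  have hv : ∀ k, ‖(if k = j then w else 1 : ℂ)‖ = 1 := by
    intro k
    split_ifs
    · exact hw.norm'_eq_one n.succ_ne_zero
    · simp
  have hprod : ∀ z : Idx n d, ∏ i, (if z i = j then w else 1 : ℂ) = w ^ letterCount z j := by
    intro z
    rw [Finset.prod_ite, Finset.prod_const, Finset.prod_const_one, mul_one, letterCount,
      Fintype.card_subtype]
  have hlt : ∀ z : Idx n d, letterCount z j < n + 1 := fun z => by
    have : letterCount z j ≤ n := by
      simpa [letterCount] using Fintype.card_subtype_le fun i => z i = j
    omega
  have h := hA.mul_prod_eq (fun k => if k = j then w else 1) hv x y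
  rw [hprod, hprod, mul_comm] at h
  exact (hw.pow_inj (hlt y) (hlt x) (mul_right_cancel₀ h0 h)).symm

/-- The projection onto the span of the basis vectors in a word class. -/
def classProj {n d : ℕ} (c : WordClass n d) : Matrix (Idx n d) (Idx n d) ℂ :=
  Matrix.diagonal fun x => if cls x = c then 1 else 0

lemma classProj_mul_self {n d : ℕ} (c : WordClass n d) :
    classProj c * classProj c = classProj c := by
  simp [classProj, Matrix.diagonal_mul_diagonal]

lemma isHermitian_classProj {n d : ℕ} (c : WordClass n d) : (classProj c).IsHermitian := by
  rw [Matrix.IsHermitian, classProj, Matrix.diagonal_conjTranspose]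
  congr 1
  funext x
  by_cases h : cls x = c <;> simp [h]

lemma IsSymmetric.commute_classProj {n d : ℕ} {A : Matrix (Idx n d) (Idx n d) ℂ}
    (hA : IsSymmetric A) (c : WordClass n d) : Commute A (classProj c) := by
  ext x y
  rw [classProj, Matrix.mul_diagonal, Matrix.diagonal_mul, mul_comm]
  by_cases h : cls x = cls y
  · rw [h]
  · rw [hA.apply_eq_zero h, mul_zero, mul_zero]

/-! ### Determinants on word classes -/

/-- The determinant of the block of a matrix on a word class. -/
def classDet {n d : ℕ} (c : WordClass n d) (A : Matrix (Idx n d) (Idx n d) ℂ) : ℂ :=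
  (classProj c * A + (1 - classProj c)).det

/-- The full-size form suits products and exponentials; the block form shows that the degree in the
matrix entries is the size of the class. -/
lemma classDet_eq_det_submatrix {n d : ℕ} (c : WordClass n d)
    (A : Matrix (Idx n d) (Idx n d) ℂ) :
    classDet c A = (A.submatrix (Subtype.val : {x // cls x = c} → Idx n d) Subtype.val).det := by
  have hne : ∀ x : Idx n d, cls x ≠ c → ∀ y,
      (classProj c * A + (1 - classProj c)) x y = (1 : Matrix (Idx n d) (Idx n d) ℂ) x y := by
    intro x hx y
    by_cases hxy : x = y
    · subst hxy
      simp [classProj, Matrix.diagonal_mul, hx]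
    · simp [classProj, Matrix.diagonal_mul, hx, Matrix.diagonal_apply_ne _ hxy]
  rw [classDet, Matrix.twoBlockTriangular_det _ (fun x => cls x = c)]
  · have h1 : (classProj c * A + (1 - classProj c)).toSquareBlockProp (fun x => cls x = c) =
        A.submatrix Subtype.val Subtype.val := by
      ext ⟨x, hx⟩ ⟨y, hy⟩
      by_cases hxy : x = y
      · subst hxy
        simp [classProj, Matrix.toSquareBlockProp, Matrix.toBlock, Matrix.diagonal_mul, hx]
      · simp [classProj, Matrix.toSquareBlockProp, Matrix.toBlock, Matrix.diagonal_mul, hx,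
          Matrix.diagonal_apply_ne _ hxy, Matrix.one_apply_ne hxy]
    have h2 : (classProj c * A + (1 - classProj c)).toSquareBlockProp (fun x => ¬ cls x = c) =
        1 := by
      ext ⟨x, hx⟩ ⟨y, hy⟩
      rw [Matrix.toSquareBlockProp, Matrix.toBlock_apply, hne x hx]
      simp [Matrix.one_apply]
    rw [h1, h2, Matrix.det_one, mul_one]
  · intro x hx y hy
    rw [hne x hx, Matrix.one_apply_ne]
    rintro rfl
    exact hx hy

lemma classDet_one {n d : ℕ} (c : WordClass n d) : classDet c 1 = 1 := by
  simp [classDet]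

lemma classDet_mul {n d : ℕ} (c : WordClass n d) {A : Matrix (Idx n d) (Idx n d) ℂ}
    (hA : Commute A (classProj c)) (B : Matrix (Idx n d) (Idx n d) ℂ) :
    classDet c (A * B) = classDet c A * classDet c B := by
  rw [classDet, classDet, classDet, ← Matrix.det_mul]
  congr 1
  have h := classProj_mul_self c
  have hA' : classProj c * A = A * classProj c := hA.eq.symm
  set P := classProj c
  have h1 : P * A * P = P * A := by rw [mul_assoc, ← hA', ← mul_assoc, h]
  calc P * (A * B) + (1 - P) = (P * A) * B + (1 - P) := by rw [mul_assoc]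
    _ = (P * A * P) * B + (P * A - P * A * P) + (P * B - P * P * B) + (1 - P - P + P * P) := by
        rw [h1, h]; noncomm_ring
    _ = _ := by noncomm_ring

/-! ### Exponentials and the weighted character -/

lemma det_exp_of_isHermitian {ι : Type*} [Fintype ι] [DecidableEq ι] {H : Matrix ι ι ℂ}
    (hH : H.IsHermitian) :
    (NormedSpace.exp ((-Complex.I) • H)).det = Complex.exp (-Complex.I * H.trace) := by
  have hs := hH.spectral_theorem
  rw [Unitary.conjStarAlgAut_apply] at hs
  set W : Matrix ι ι ℂ := (hH.eigenvectorUnitary : Matrix ι ι ℂ)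
  have hW : W * star W = 1 := Unitary.coe_mul_star_self hH.eigenvectorUnitary
  have hW' : star W = W⁻¹ := (Matrix.inv_eq_right_inv hW).symm
  have hu : IsUnit W := (Matrix.isUnit_iff_isUnit_det _).2 (Matrix.isUnit_det_of_right_inverse hW)
  rw [hW'] at hs
  have e : (-Complex.I) • H = W * Matrix.diagonal
      ((-Complex.I) • (RCLike.ofReal ∘ hH.eigenvalues : ι → ℂ)) * W⁻¹ := by
    conv_lhs => rw [hs]
    rw [Matrix.diagonal_smul, Matrix.mul_smul, Matrix.smul_mul]
  rw [e, Matrix.exp_conj _ _ hu, Matrix.det_conj hu, Matrix.exp_diagonal, Matrix.det_diagonal,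
    hH.trace_eq_sum_eigenvalues, Finset.mul_sum, Complex.exp_sum]
  refine Finset.prod_congr rfl fun i _ => ?_
  rw [Pi.coe_exp, ← Complex.exp_eq_exp_ℂ]
  simp

-- `P * A` and `(1 - P) * A` commute and add up to `A`, and the exponential of each acts trivially
-- on the other's block.
open scoped Matrix.Norms.Operator in
lemma exp_mul_of_commute {ι : Type*} [Fintype ι] [DecidableEq ι] {P A : Matrix ι ι ℂ}
    (hP : P * P = P) (h : Commute A P) :
    NormedSpace.exp (P * A) = P * NormedSpace.exp A + (1 - P) := by
  have hc : P * A = A * P := h.eq.symm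
  have h0 : ∀ X Y : Matrix ι ι ℂ, Y * X = 0 → Y * NormedSpace.exp X = Y := by
    intro X Y hXY
    have : SemiconjBy Y X 0 := by rw [SemiconjBy, hXY, zero_mul]
    have e := this.exp_right.eq
    rw [NormedSpace.exp_zero, one_mul] at e
    exact e
  have h1 : (1 - P) * NormedSpace.exp (P * A) = 1 - P := by
    apply h0
    rw [← mul_assoc, sub_mul, hP, one_mul, sub_self, zero_mul]
  have h2 : P * NormedSpace.exp ((1 - P) * A) = P := by
    apply h0
    rw [← mul_assoc, mul_sub, hP, mul_one, sub_self, zero_mul]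
  have hcomm : Commute ((1 - P) * A) (P * A) := by
    have e1 : P * A * (P * A) = P * A * A := by
      calc P * A * (P * A) = P * (A * P) * A := by simp only [mul_assoc]
        _ = P * P * A * A := by rw [← hc]; simp only [mul_assoc]
        _ = P * A * A := by rw [hP]
    have e2 : A * (P * A) = P * A * A := by rw [← mul_assoc, ← hc]
    rw [Commute, SemiconjBy, sub_mul, one_mul, sub_mul, mul_sub, e1, e2]
  have h3 : NormedSpace.exp A =
      NormedSpace.exp ((1 - P) * A) * NormedSpace.exp (P * A) := by
    rw [← Matrix.exp_add_of_commute _ _ hcomm]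
    congr 1
    noncomm_ring
  rw [h3, ← mul_assoc, h2]
  conv_rhs => rw [← h1]
  noncomm_ring

lemma classDet_exp {n d : ℕ} (c : WordClass n d) {H : Matrix (Idx n d) (Idx n d) ℂ}
    (hH : H.IsHermitian) (hc : Commute H (classProj c)) :
    classDet c (NormedSpace.exp ((-Complex.I) • H)) =
      Complex.exp (-Complex.I * ∑ x, if cls x = c then H x x else 0) := by
  have hPH : (classProj c * H).IsHermitian := by
    rw [Matrix.IsHermitian, Matrix.conjTranspose_mul, hH.eq, (isHermitian_classProj c).eq, hc.eq]
  rw [classDet, ← exp_mul_of_commute (classProj_mul_self c) (hc.smul_left _), Matrix.mul_smul,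
    det_exp_of_isHermitian hPH]
  simp [Matrix.trace, classProj, Matrix.diagonal_mul]

/-- The character `∏ det(U_c) ^ m c` for integer weights `m` on word classes; negative powers are
written with complex conjugates. -/
def weightChar {n d : ℕ} (m : WordClass n d → ℤ) (A : Matrix (Idx n d) (Idx n d) ℂ) : ℂ :=
  ∏ c, (classDet c A ^ (m c).toNat * (starRingEnd ℂ) (classDet c A) ^ (-m c).toNat)

lemma weightChar_mul {n d : ℕ} (m : WordClass n d → ℤ) {A : Matrix (Idx n d) (Idx n d) ℂ}
    (hA : IsSymmetric A) (B : Matrix (Idx n d) (Idx n d) ℂ) :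
    weightChar m (A * B) = weightChar m A * weightChar m B := by
  rw [weightChar, weightChar, weightChar, ← Finset.prod_mul_distrib]
  refine Finset.prod_congr rfl fun c _ => ?_
  rw [classDet_mul c (hA.commute_classProj c), map_mul, mul_pow, mul_pow]
  ring

lemma weightChar_exp {n d : ℕ} (m : WordClass n d → ℤ) {H : Matrix (Idx n d) (Idx n d) ℂ}
    (hH : H.IsHermitian) (hc : ∀ c, Commute H (classProj c)) :
    weightChar m (NormedSpace.exp ((-Complex.I) • H)) =
      Complex.exp (-Complex.I * ∑ x, (m (cls x) : ℂ) * H x x) := by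
  have hreal : ∀ x, (starRingEnd ℂ) (H x x) = H x x := fun x => hH.apply x x
  have h1 : ∀ x, (m (cls x) : ℂ) * H x x = ∑ c, (m c : ℂ) * if cls x = c then H x x else 0 := by
    intro x
    simp
  have h2 : ∑ x, (m (cls x) : ℂ) * H x x =
      ∑ c, (m c : ℂ) * ∑ x, if cls x = c then H x x else 0 := by
    simp_rw [h1]
    rw [Finset.sum_comm]
    simp_rw [Finset.mul_sum]
  rw [h2, Finset.mul_sum, Complex.exp_sum, weightChar]
  refine Finset.prod_congr rfl fun c _ => ?_
  rw [classDet_exp c hH (hc c), ← Complex.exp_conj, ← Complex.exp_nat_mul, ← Complex.exp_nat_mul,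
    ← Complex.exp_add]
  congr 1
  -- The trace of `H` over a class is real, so conjugating the determinant inverts it; this is what
  -- lets conjugates stand for negative powers.
  have h3 : (starRingEnd ℂ) (∑ x, if cls x = c then H x x else 0) =
      ∑ x, if cls x = c then H x x else 0 := by
    rw [map_sum]
    refine Finset.sum_congr rfl fun x _ => ?_
    split_ifs
    · exact hreal x
    · simp
  rw [map_mul, map_neg, Complex.conj_I, h3]
  have h4 : (m c : ℂ) = ((m c).toNat : ℂ) - ((-m c).toNat : ℂ) := by
    have := Int.toNat_sub_toNat_neg (m c)
    exact_mod_cast this.symm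
  rw [h4]
  ring

/-- `weightChar` as a character of the group of symmetric unitaries. -/
def weightHom {n d : ℕ} (m : WordClass n d → ℤ) : SymU n d →* ℂ where
  toFun U := weightChar m U.mat
  map_one' := by
    change weightChar m 1 = 1
    simp [weightChar, classDet_one]
  map_mul' U W := weightChar_mul m U.2 W.mat

lemma continuous_weightHom {n d : ℕ} (m : WordClass n d → ℤ) : Continuous (weightHom m) := by
  have h : ∀ c : WordClass n d, Continuous fun U : SymU n d => classDet c U.mat := fun c =>
    Continuous.matrix_det (by have := SymU.continuous_mat (n := n) (d := d); fun_prop)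
  refine continuous_finsetProd _ fun c _ => ?_
  exact ((h c).pow _).mul ((Complex.continuous_conj.comp (h c)).pow _)

/-! ### The character is trivial on local gates -/

lemma sum_weight_mul_eq_zero {n d γ : ℕ} (hγ : γ ≤ n) {m : WordClass n d → ℤ}
    (hm : ∀ (ι : Fin γ ↪ Fin n) (b : Idx γ d → ℂ),
      ∑ x : Idx n d, (m (cls x) : ℂ) * b (x ∘ ι) = 0)
    {S : Finset (Fin n)} (hS : S.card ≤ γ) {h : Idx n d → ℂ}
    (hh : ∀ x y : Idx n d, (∀ i ∈ S, x i = y i) → h x = h y) :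
    ∑ x, (m (cls x) : ℂ) * h x = 0 := by
  classical
  -- The vanishing marginals are for exactly `γ` positions, so `S` is enlarged; this uses `γ ≤ n`.
  obtain ⟨S', hSS', hS'⟩ := Finset.exists_superset_card_eq hS (by simpa using hγ)
  let ι : Fin γ ↪ Fin n := (S'.orderEmbOfFin hS').toEmbedding
  rw [← hm ι fun w => if hw : ∃ x : Idx n d, x ∘ ι = w then h hw.choose else 0]
  refine Finset.sum_congr rfl fun x _ => ?_
  have hw : ∃ y : Idx n d, y ∘ ι = x ∘ ι := ⟨x, rfl⟩
  rw [dif_pos hw]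
  congr 1
  refine hh _ _ fun i hi => ?_
  obtain ⟨j, rfl⟩ : i ∈ Set.range ι := by
    change i ∈ Set.range (S'.orderEmbOfFin hS')
    rw [Finset.range_orderEmbOfFin]
    exact hSS' hi
  exact (congrFun hw.choose_spec j).symm

lemma ActsOn.diag_eq {n d : ℕ} {S : Finset (Fin n)} {A : Matrix (Idx n d) (Idx n d) ℂ}
    (hA : ActsOn S A) (x y : Idx n d) (h : ∀ i ∈ S, x i = y i) : A x x = A y y := by
  obtain ⟨B, hB⟩ := hA
  rw [hB, hB]
  have : (fun i : S => x i) = fun i : S => y i := funext fun i => h i i.2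
  simp [this]

lemma sum_weight_mul_diag_eq_zero {n d γ : ℕ} (hγ : γ ≤ n) {m : WordClass n d → ℤ}
    (hm : ∀ (ι : Fin γ ↪ Fin n) (b : Idx γ d → ℂ),
      ∑ x : Idx n d, (m (cls x) : ℂ) * b (x ∘ ι) = 0)
    {H : Matrix (Idx n d) (Idx n d) ℂ} (hH : H ∈ Submodule.span ℂ {A | IsLocal γ A}) :
    ∑ x, (m (cls x) : ℂ) * H x x = 0 := by
  induction hH using Submodule.span_induction with
  | mem A hA =>
    obtain ⟨S, hS, hA⟩ := hA
    exact sum_weight_mul_eq_zero hγ hm hS (h := fun x => A x x) hA.diag_eq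
  | zero => simp
  | add A B _ _ hA hB => simp [mul_add, Finset.sum_add_distrib, hA, hB]
  | smul z A _ hA =>
    have : ∀ x, (m (cls x) : ℂ) * (z • A) x x = z * ((m (cls x) : ℂ) * A x x) := fun x => by
      simp only [Matrix.smul_apply, smul_eq_mul]; ring
    simp_rw [this, ← Finset.mul_sum, hA, mul_zero]

open scoped Matrix.Norms.L2Operator in
/-- A unitary matrix is the exponential of a Hermitian matrix that commutes with everything the
unitary commutes with. -/
lemma exists_hermitian_log {ι : Type*} [Fintype ι] [DecidableEq ι] {U : Matrix ι ι ℂ}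
    (hU : U ∈ Matrix.unitaryGroup ι ℂ) :
    ∃ H : Matrix ι ι ℂ, H.IsHermitian ∧ U = NormedSpace.exp ((-Complex.I) • H) ∧
      ∀ B, Commute U B → Commute H B := by
  have hfin : (spectrum ℂ U).Finite := Matrix.finite_spectrum U
  have hcont : ∀ f : ℂ → ℂ, ContinuousOn f (spectrum ℂ U) := fun f => hfin.continuousOn f
  have hcont' : ∀ f g : ℂ → ℂ, ContinuousOn f (g '' spectrum ℂ U) :=
    fun f g => (hfin.image g).continuousOn f
  have hUn : IsStarNormal U := by
    exact ⟨(Matrix.mem_unitaryGroup_iff'.1 hU).trans (Matrix.mem_unitaryGroup_iff.1 hU).symm⟩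
  -- The spectrum is finite, so the functional calculus applies to the discontinuous `arg`.
  let H : Matrix ι ι ℂ := cfc (fun z : ℂ => ((-z.arg : ℝ) : ℂ)) U
  have hsa : IsSelfAdjoint H := by
    change star (cfc _ U) = cfc _ U
    rw [← cfc_star]
    simp
  have hexp : U = NormedSpace.exp ((-Complex.I) • H) := by
    have hHn : IsStarNormal H := hsa.isStarNormal
    rw [← CFC.exp_eq_normedSpace_exp (𝕜 := ℂ), ← cfc_comp_smul (-Complex.I) _ H, ← cfc_comp' _ _ U
      (hg := hcont' _ _) (hf := hcont _)]
    conv_lhs => rw [← cfc_id' ℂ U]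
    refine cfc_congr fun z hz => ?_
    have hz1 : ‖z‖ = 1 := spectrum.norm_eq_one_of_unitary hU hz
    have := Complex.norm_mul_exp_arg_mul_I z
    rw [hz1, Complex.ofReal_one, one_mul] at this
    simp only [← Complex.exp_eq_exp_ℂ, smul_eq_mul]
    conv_lhs => rw [← this]
    congr 1
    push_cast
    ring
  refine ⟨H, hsa, hexp, fun B hB => ?_⟩
  refine Commute.cfc hB ?_ _
  have h1 := Matrix.mem_unitaryGroup_iff.1 hU
  have h2 := Matrix.mem_unitaryGroup_iff'.1 hU
  calc star U * B = star U * B * (U * star U) := by rw [h1, mul_one]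
    _ = star U * (B * U) * star U := by simp only [mul_assoc]
    _ = star U * (U * B) * star U := by rw [hB.eq]
    _ = (star U * U) * (B * star U) := by simp only [mul_assoc]
    _ = B * star U := by rw [h2, one_mul]

/-- Only the diagonal of the logarithm `H` matters. Since `U` commutes with basis permutations
acting outside `S`, so does `H`, and its diagonal depends on the letters in `S` alone. -/
lemma weightHom_eq_one_of_actsOn {n d γ : ℕ} (hγ : γ ≤ n) {m : WordClass n d → ℤ}
    (hm : ∀ (ι : Fin γ ↪ Fin n) (b : Idx γ d → ℂ),
      ∑ x : Idx n d, (m (cls x) : ℂ) * b (x ∘ ι) = 0)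
    {S : Finset (Fin n)} (hS : S.card ≤ γ) {U : SymU n d} (hU : ActsOn S U.mat) :
    weightHom m U = 1 := by
  obtain ⟨H, hH, hexp, hcomm⟩ := exists_hermitian_log U.1.2
  have hd : ∀ x y : Idx n d, (∀ i ∈ S, x i = y i) → H x x = H y y := by
    intro x y hxy
    -- Swapping `x i` with `y i` at each position carries `x` to `y` and does nothing on `S`, where
    -- they agree.
    let e : Equiv.Perm (Idx n d) := Equiv.piCongrRight fun i => Equiv.swap (x i) (y i)
    have heS : ∀ (u : Idx n d), ∀ i ∈ S, e u i = u i := by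
      intro u i hi
      change Equiv.swap (x i) (y i) (u i) = u i
      rw [hxy i hi, Equiv.swap_self]
      rfl
    have hex : e x = y := funext fun i => Equiv.swap_apply_left _ _
    have hUe : ∀ u v, U.mat (e u) (e v) = U.mat u v := by
      obtain ⟨B, hB⟩ := hU
      intro u v
      rw [hB, hB]
      have h1 : (fun i : S => e u i) = fun i : S => u i := funext fun i => heS u i i.2
      have h2 : (fun i : S => e v i) = fun i : S => v i := funext fun i => heS v i i.2
      have h3 : (∀ i, i ∉ S → e u i = e v i) ↔ ∀ i, i ∉ S → u i = v i :=
        forall₂_congr fun i _ => (Equiv.swap (x i) (y i)).injective.eq_iff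
      rw [h1, h2]
      simp only [h3]
    have hC : Commute U.mat (e.toPEquiv.toMatrix : Matrix (Idx n d) (Idx n d) ℂ) := by
      ext u v
      rw [PEquiv.mul_toMatrix_toPEquiv, PEquiv.toMatrix_toPEquiv_mul]
      simp only [Matrix.submatrix_apply, id]
      rw [← hUe u, Equiv.apply_symm_apply]
    have h := congrFun (congrFun (hcomm _ hC).eq x) y
    rw [PEquiv.mul_toMatrix_toPEquiv, PEquiv.toMatrix_toPEquiv_mul] at h
    simp only [Matrix.submatrix_apply, id] at h
    rw [← hex, Equiv.symm_apply_apply] at h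
    rw [h, hex]
  change weightChar m U.mat = 1
  have hexp' : U.mat = _ := hexp
  rw [hexp', weightChar_exp m hH fun c => hcomm _ (IsSymmetric.commute_classProj U.2 c),
    sum_weight_mul_eq_zero hγ hm hS (h := fun x => H x x) hd]
  simp

lemma weightHom_eq_one {n d γ : ℕ} (hγ : γ ≤ n) {m : WordClass n d → ℤ}
    (hm : ∀ (ι : Fin γ ↪ Fin n) (b : Idx γ d → ℂ),
      ∑ x : Idx n d, (m (cls x) : ℂ) * b (x ∘ ι) = 0)
    {U : SymU n d} (hU : U ∈ localGroup n d γ) : weightHom m U = 1 := by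
  have hker : localGroup n d γ ≤ (weightHom m).ker := by
    refine Subgroup.topologicalClosure_minimal _ ?_ ?_
    · rw [Subgroup.closure_le]
      rintro W (⟨S, hS, hW⟩ | ⟨H, ⟨hH, hsym, hloc⟩, hW⟩)
      · exact weightHom_eq_one_of_actsOn hγ hm hS hW
      · change weightChar m W.mat = 1
        rw [hW, weightChar_exp m hH hsym.commute_classProj,
          sum_weight_mul_diag_eq_zero hγ hm hloc]
        simp
    · exact isClosed_eq (continuous_weightHom m) continuous_const
  exact hker hU

/-! ### Lower bounds on the diamond norm -/

open scoped ComplexOrder in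
lemma traceNorm_pos {ι : Type} [Fintype ι] [DecidableEq ι] {A : Matrix ι ι ℂ} (hA : A ≠ 0) :
    0 < traceNorm A := by
  have hH := Matrix.isHermitian_conjTranspose_mul_self A
  have hnn : ∀ i, 0 ≤ hH.eigenvalues i :=
    (Matrix.posSemidef_conjTranspose_mul_self A).eigenvalues_nonneg
  refine lt_of_le_of_ne (Finset.sum_nonneg fun i _ => Real.sqrt_nonneg _) fun h0 => hA ?_
  have h1 := (Finset.sum_eq_zero_iff_of_nonneg fun i _ => Real.sqrt_nonneg _).1 h0.symm
  have h2 : hH.eigenvalues = 0 := funext fun i =>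
    (Real.sqrt_eq_zero (hnn i)).1 (h1 i (Finset.mem_univ i))
  exact Matrix.conjTranspose_mul_self_eq_zero.1 (hH.eigenvalues_eq_zero_iff.1 h2)

-- Cauchy–Schwarz on the singular values. The right side scales visibly, which is enough to shrink a
-- matrix into the unit ball of the trace norm.
open scoped ComplexOrder in
lemma traceNorm_le {ι : Type} [Fintype ι] [DecidableEq ι] (A : Matrix ι ι ℂ) :
    traceNorm A ≤ √(Fintype.card ι * (Aᴴ * A).trace.re) := by
  have hH := Matrix.isHermitian_conjTranspose_mul_self A
  have hnn : ∀ i, 0 ≤ hH.eigenvalues i :=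
    (Matrix.posSemidef_conjTranspose_mul_self A).eigenvalues_nonneg
  refine Real.le_sqrt_of_sq_le ?_
  rw [hH.trace_eq_sum_eigenvalues]
  have h := sq_sum_le_card_mul_sum_sq (s := Finset.univ) (f := fun i => √(hH.eigenvalues i))
  simp only [Real.sq_sqrt (hnn _)] at h
  simpa [traceNorm] using h

/-- A rescaled `M`, with a one-dimensional ancilla, is a test input that every such `Φ` returns
unchanged; hence `δ` depends on `M` only. -/
lemma exists_le_diamondNorm {ι : Type} [Fintype ι] [DecidableEq ι] {M : Matrix ι ι ℂ}
    (hM : M ≠ 0) : ∃ δ > (0 : ℝ), ∀ Φ : Module.End ℂ (Matrix ι ι ℂ), Φ M = M →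
      ENNReal.ofReal δ ≤ diamondNorm Φ := by
  let B : Matrix (ι × Fin 1) (ι × Fin 1) ℂ := Matrix.of fun p q => M p.1 q.1
  have hB : B ≠ 0 := fun h => hM <| by
    ext x y
    exact congrFun (congrFun h (x, 0)) (y, 0)
  set C : ℝ := √(Fintype.card (ι × Fin 1) * (Bᴴ * B).trace.re) with hC
  have hC0 : 0 ≤ C := Real.sqrt_nonneg _
  let t : ℝ := (C + 1)⁻¹
  have ht : 0 < t := by positivity
  have htB : (t : ℂ) • B ≠ 0 := smul_ne_zero (by exact_mod_cast ht.ne') hB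
  refine ⟨traceNorm ((t : ℂ) • B), traceNorm_pos htB, fun Φ hΦ => ?_⟩
  have hle : traceNorm ((t : ℂ) • B) ≤ 1 := by
    refine (traceNorm_le _).trans ?_
    have e : ((((t : ℂ) • B)ᴴ * ((t : ℂ) • B)).trace).re = t ^ 2 * (Bᴴ * B).trace.re := by
      rw [Matrix.conjTranspose_smul, Matrix.smul_mul, Matrix.mul_smul, smul_smul,
        Matrix.trace_smul, smul_eq_mul]
      have : star (t : ℂ) * (t : ℂ) = ((t ^ 2 : ℝ) : ℂ) := by
        rw [RCLike.star_def, Complex.conj_ofReal]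
        push_cast
        ring
      rw [this, Complex.re_ofReal_mul]
    rw [e, mul_left_comm, Real.sqrt_mul (by positivity), Real.sqrt_sq ht.le, ← hC]
    change (C + 1)⁻¹ * C ≤ 1
    rw [inv_mul_le_iff₀ (by positivity)]
    linarith
  have hamp : ampliation Φ 1 ((t : ℂ) • B) = (t : ℂ) • B := by
    ext p q
    have : (Matrix.of fun x y => ((t : ℂ) • B) (x, p.2) (y, q.2)) = (t : ℂ) • M := by
      ext x y
      rfl
    rw [ampliation, Matrix.of_apply, this, map_smul, hΦ]
    rfl
  have := le_iSup₂_of_le (f := fun (r : ℕ) (X : Matrix (ι × Fin r) (ι × Fin r) ℂ) =>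
    ⨆ _ : traceNorm X ≤ 1, ENNReal.ofReal (traceNorm (ampliation Φ r X))) 1 ((t : ℂ) • B)
    (le_iSup_of_le hle le_rfl)
  rwa [hamp] at this

/-! ### Matrix coefficients of tensor powers -/

lemma tensorPow_mul {ι : Type} [Fintype ι] (k : ℕ) (A B : Matrix ι ι ℂ) :
    tensorPow k (A * B) = tensorPow k A * tensorPow k B := by
  classical
  ext x y
  simp only [tensorPow, Matrix.of_apply, Matrix.mul_apply, ← Finset.prod_mul_distrib]
  rw [Finset.prod_univ_sum, Fintype.piFinset_univ]

lemma prod_mem_pow {A κ : Type*} [CommRing A] [Algebra ℂ A] (E : Submodule ℂ A)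
    (s : Finset κ) (f : κ → A) (k : κ → ℕ) (h : ∀ i ∈ s, f i ∈ E ^ k i) :
    ∏ i ∈ s, f i ∈ E ^ ∑ i ∈ s, k i := by
  classical
  induction s using Finset.induction_on with
  | empty => simpa using Submodule.mem_one.2 ⟨1, map_one _⟩
  | insert a s ha ih =>
    rw [Finset.prod_insert ha, Finset.sum_insert ha, pow_add]
    exact Submodule.mul_mem_mul (h a (Finset.mem_insert_self a s))
      (ih fun i hi => h i (Finset.mem_insert_of_mem hi))

/-- The span of the matrix entries, as functions on the group of symmetric unitaries. -/
def entrySpan (n d : ℕ) : Submodule ℂ (SymU n d → ℂ) :=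
  Submodule.span ℂ (Set.range fun p : Idx n d × Idx n d => fun U : SymU n d => U.mat p.1 p.2)

/-- The span of the complex conjugates of the matrix entries. -/
def conjEntrySpan (n d : ℕ) : Submodule ℂ (SymU n d → ℂ) :=
  Submodule.span ℂ (Set.range fun p : Idx n d × Idx n d =>
    fun U : SymU n d => (starRingEnd ℂ) (U.mat p.1 p.2))

lemma det_mem_pow {n d : ℕ} (E : Submodule ℂ (SymU n d → ℂ)) {κ : Type*} [Fintype κ]
    [DecidableEq κ] (F : SymU n d → Matrix κ κ ℂ) (hF : ∀ x y, (fun U => F U x y) ∈ E) :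
    (fun U => (F U).det) ∈ E ^ Fintype.card κ := by
  have e : (fun U => (F U).det) = ∑ σ : Equiv.Perm κ,
      ((Equiv.Perm.sign σ : ℤ) : ℂ) • ∏ i, fun U => F U (σ i) i := by
    funext U
    rw [Matrix.det_apply']
    simp [Finset.sum_apply, Finset.prod_apply]
  rw [e]
  refine Submodule.sum_mem _ fun σ _ => Submodule.smul_mem _ _ ?_
  have := prod_mem_pow E Finset.univ (fun i => fun U => F U (σ i) i) (fun _ => 1) fun i _ => by
    simpa using hF (σ i) i
  simpa using this

lemma classDet_mem {n d : ℕ} (c : WordClass n d) :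
    (fun U : SymU n d => classDet c U.mat) ∈
      entrySpan n d ^ Fintype.card {x : Idx n d // cls x = c} := by
  simp_rw [classDet_eq_det_submatrix]
  exact det_mem_pow _ (fun U => U.mat.submatrix Subtype.val Subtype.val)
    fun x y => Submodule.subset_span ⟨(x.1, y.1), rfl⟩

lemma conj_classDet_mem {n d : ℕ} (c : WordClass n d) :
    (fun U : SymU n d => (starRingEnd ℂ) (classDet c U.mat)) ∈
      conjEntrySpan n d ^ Fintype.card {x : Idx n d // cls x = c} := by
  simp_rw [classDet_eq_det_submatrix, RingHom.map_det]
  exact det_mem_pow _ (fun U => (starRingEnd ℂ).mapMatrix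
    (U.mat.submatrix Subtype.val Subtype.val)) fun x y => Submodule.subset_span ⟨(x.1, y.1), rfl⟩

/-- A row of a unitary has norm one. This allows padding a matrix coefficient to higher tensor
powers. -/
lemma one_mem_entrySpan_mul {n d : ℕ} [Nonempty (Idx n d)] :
    (1 : SymU n d → ℂ) ∈ entrySpan n d * conjEntrySpan n d := by
  obtain ⟨x⟩ := ‹Nonempty (Idx n d)›
  have e : (1 : SymU n d → ℂ) = ∑ y, (fun U : SymU n d => U.mat x y) *
      fun U : SymU n d => (starRingEnd ℂ) (U.mat x y) := by
    funext U
    have h := congrFun (congrFun (Matrix.mem_unitaryGroup_iff.1 U.1.2) x) x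
    rw [Matrix.mul_apply, Matrix.one_apply_eq] at h
    simp only [Pi.one_apply, Finset.sum_apply, Pi.mul_apply]
    exact h.symm
  rw [e]
  exact Submodule.sum_mem _ fun y _ => Submodule.mul_mem_mul
    (Submodule.subset_span ⟨(x, y), rfl⟩) (Submodule.subset_span ⟨(x, y), rfl⟩)

lemma exists_weightHom_mem {n d : ℕ} [Nonempty (Idx n d)] {m : WordClass n d → ℤ}
    (hm : ∑ x : Idx n d, m (cls x) = 0) :
    ∃ k₀, ∀ k ≥ k₀, ⇑(weightHom m) ∈ entrySpan n d ^ k * conjEntrySpan n d ^ k := by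
  let N : WordClass n d → ℕ := fun c => Fintype.card {x : Idx n d // cls x = c}
  let k₀ := ∑ c, N c * (m c).toNat
  -- Total weight zero makes the degree in the entries equal to the degree in their conjugates.
  have hbal : k₀ = ∑ c, N c * (-m c).toNat := by
    have h1 : ∑ c, (N c : ℤ) * m c = 0 := by
      rw [← hm, ← Fintype.sum_fiberwise (g := fun x : Idx n d => cls x)]
      refine Finset.sum_congr rfl fun c _ => ?_
      rw [Finset.sum_congr rfl fun (x : {x : Idx n d // cls x = c}) _ => congrArg m x.2]
      simp [N]
    have h2 : ∀ c, (N c : ℤ) * m c =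
        ((N c * (m c).toNat : ℕ) : ℤ) - ((N c * (-m c).toNat : ℕ) : ℤ) := by
      intro c
      conv_lhs => rw [← Int.toNat_sub_toNat_neg (m c)]
      push_cast
      ring
    simp_rw [h2, Finset.sum_sub_distrib, ← Nat.cast_sum] at h1
    exact_mod_cast sub_eq_zero.1 h1
  refine ⟨k₀, fun k hk => ?_⟩
  have h0 : ⇑(weightHom m) = (∏ c, (fun U : SymU n d => classDet c U.mat) ^ (m c).toNat) *
      ∏ c, (fun U : SymU n d => (starRingEnd ℂ) (classDet c U.mat)) ^ (-m c).toNat := by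
    funext U
    change weightChar m U.mat = _
    simp [weightChar, Finset.prod_mul_distrib, Finset.prod_apply]
  have h1 : ⇑(weightHom m) ∈ entrySpan n d ^ k₀ * conjEntrySpan n d ^ k₀ := by
    rw [h0]
    refine Submodule.mul_mem_mul (prod_mem_pow _ _ _ _ fun c _ => ?_) ?_
    · rw [pow_mul]
      exact Submodule.pow_mem_pow _ (classDet_mem c) _
    · rw [hbal]
      refine prod_mem_pow _ _ _ _ fun c _ => ?_
      rw [pow_mul]
      exact Submodule.pow_mem_pow _ (conj_classDet_mem c) _
  have h2 := Submodule.mul_mem_mul h1 (Submodule.pow_mem_pow _ one_mem_entrySpan_mul (k - k₀))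
  rw [one_pow, mul_one, mul_pow, mul_mul_mul_comm, ← pow_add, ← pow_add,
    Nat.add_sub_cancel' hk] at h2
  exact h2

/-- A matrix coefficient of `U^{⊗ k} ⊗ Ū^{⊗ k}`. -/
def coeffFun {n d k : ℕ} (x a y b : Fin k → Idx n d) (U : SymU n d) : ℂ :=
  tensorPow k U.mat x a * (starRingEnd ℂ) (tensorPow k U.mat y b)

lemma mem_span_coeffFun {n d k : ℕ} {g : SymU n d → ℂ}
    (hg : g ∈ entrySpan n d ^ k * conjEntrySpan n d ^ k) :
    g ∈ Submodule.span ℂ {g | ∃ x a y b : Fin k → Idx n d, g = coeffFun x a y b} := by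
  rw [entrySpan, conjEntrySpan, Submodule.span_pow, Submodule.span_pow,
    Submodule.span_mul_span] at hg
  refine Submodule.span_mono ?_ hg
  rintro _ ⟨u, hu, v, hv, rfl⟩
  obtain ⟨p, rfl⟩ := Set.mem_pow.1 hu
  obtain ⟨q, rfl⟩ := Set.mem_pow.1 hv
  choose p' hp' using fun i => (p i).2
  choose q' hq' using fun i => (q i).2
  refine ⟨fun i => (p' i).1, fun i => (p' i).2, fun i => (q' i).1, fun i => (q' i).2, ?_⟩
  simp_rw [← hp', ← hq']
  funext U
  simp [coeffFun, tensorPow, List.prod_ofFn, Finset.prod_apply]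

lemma continuous_tensorPow_apply {n d k : ℕ} (x a : Fin k → Idx n d) :
    Continuous fun U : SymU n d => tensorPow k U.mat x a := by
  simp only [tensorPow, Matrix.of_apply]
  exact continuous_finsetProd _ fun i _ => SymU.continuous_mat.matrix_elem _ _

lemma continuous_coeffFun {n d k : ℕ} (x a y b : Fin k → Idx n d) :
    Continuous (coeffFun x a y b) :=
  (continuous_tensorPow_apply x a).mul
    (Complex.continuous_conj.comp (continuous_tensorPow_apply y b))

lemma integrable_of_continuous {n d : ℕ} {g : SymU n d → ℂ} (hg : Continuous g)
    (ν : Measure (SymU n d)) [IsFiniteMeasure ν] : Integrable g ν := by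
  simpa using hg.continuousOn.integrableOn_compact (μ := ν) isCompact_univ

instance (n d : ℕ) : (haarSym n d).IsMulLeftInvariant := by
  unfold haarSym
  infer_instance

/-! ### An eigenvector of the twirling channels -/

lemma conjPow_apply {n d k : ℕ} (W : SymU n d)
    (M : Matrix (Fin k → Idx n d) (Fin k → Idx n d) ℂ) (x y : Fin k → Idx n d) :
    conjPow k W M x y = ∑ b, ∑ a, M a b * coeffFun x a y b W := by
  rw [conjPow, Matrix.mul_apply]
  refine Finset.sum_congr rfl fun b _ => ?_
  rw [Matrix.mul_apply, Finset.sum_mul]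
  refine Finset.sum_congr rfl fun a _ => ?_
  rw [Matrix.conjTranspose_apply, coeffFun, RCLike.star_def]
  ring

lemma coeffFun_mul {n d k : ℕ} (x a y b : Fin k → Idx n d) (W U : SymU n d) :
    coeffFun x a y b (W * U) =
      ∑ y', ∑ x', coeffFun x x' y y' W * coeffFun x' a y' b U := by
  have h : tensorPow k (W * U).mat = tensorPow k W.mat * tensorPow k U.mat :=
    tensorPow_mul k W.mat U.mat
  rw [coeffFun, h, Matrix.mul_apply, Matrix.mul_apply, map_sum, Finset.mul_sum]
  refine Finset.sum_congr rfl fun y' _ => ?_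
  rw [Finset.sum_mul]
  refine Finset.sum_congr rfl fun x' _ => ?_
  rw [coeffFun, coeffFun, map_mul]
  ring

/-- Averaging the conjugates of a matrix unit against `f U⁻¹` projects it to the `f`-eigenspace. If
all projections vanished, `U ↦ f U⁻¹` would integrate to zero against every matrix coefficient,
hence against `f`; but that integral is `1`. -/
lemma exists_conjPow_eigenvector {n d k : ℕ} {f : SymU n d →* ℂ} (hf : Continuous f)
    (hmem : ⇑f ∈ entrySpan n d ^ k * conjEntrySpan n d ^ k) :
    ∃ M : Matrix (Fin k → Idx n d) (Fin k → Idx n d) ℂ, M ≠ 0 ∧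
      ∀ U, conjPow k U M = f U • M := by
  let Φ : (x a y b : Fin k → Idx n d) → SymU n d → ℂ := fun x a y b U =>
    f U⁻¹ * coeffFun x a y b U
  have hΦ : ∀ x a y b, Continuous (Φ x a y b) := fun x a y b =>
    (hf.comp continuous_inv).mul (continuous_coeffFun x a y b)
  let M : (a b : Fin k → Idx n d) → Matrix (Fin k → Idx n d) (Fin k → Idx n d) ℂ := fun a b =>
    Matrix.of fun x y => ∫ U, Φ x a y b U ∂(haarSym n d)
  have heig : ∀ a b W, conjPow k W (M a b) = f W • M a b := by
    intro a b W
    ext x y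
    have h1 : ∀ U, ∑ y', ∑ x', Φ x' a y' b U * coeffFun x x' y y' W =
        f W * Φ x a y b (W * U) := by
      intro U
      have h2 : f U⁻¹ = f W * f (W * U)⁻¹ := by rw [mul_comm, ← map_mul]; congr 1; group
      simp only [Φ]
      rw [coeffFun_mul, ← mul_assoc, ← h2, Finset.mul_sum]
      refine Finset.sum_congr rfl fun y' _ => ?_
      rw [Finset.mul_sum]
      refine Finset.sum_congr rfl fun x' _ => ?_
      ring
    have hint : ∀ x' y', Integrable (fun U => Φ x' a y' b U * coeffFun x x' y y' W)
        (haarSym n d) := fun x' y' =>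
      integrable_of_continuous ((hΦ x' a y' b).mul continuous_const) _
    calc conjPow k W (M a b) x y
        = ∑ y', ∑ x', ∫ U, Φ x' a y' b U * coeffFun x x' y y' W ∂(haarSym n d) := by
          rw [conjPow_apply]
          refine Finset.sum_congr rfl fun y' _ => Finset.sum_congr rfl fun x' _ => ?_
          rw [integral_mul_const]
          rfl
      _ = ∫ U, ∑ y', ∑ x', Φ x' a y' b U * coeffFun x x' y y' W ∂(haarSym n d) := by
          rw [integral_finsetSum _ fun y' _ => integrable_finsetSum _ fun x' _ => hint x' y']
          refine Finset.sum_congr rfl fun y' _ => ?_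
          rw [integral_finsetSum _ fun x' _ => hint x' y']
      _ = f W * ∫ U, Φ x a y b (W * U) ∂(haarSym n d) := by
          simp_rw [h1]
          rw [integral_const_mul]
      _ = (f W • M a b) x y := by
          rw [integral_mul_left_eq_self (Φ x a y b) W]
          rfl
  by_contra hcon
  push Not at hcon
  have hzero : ∀ a b, M a b = 0 := fun a b => by
    by_contra h
    obtain ⟨U, hU⟩ := hcon _ h
    exact hU (heig a b U)
  have hspan : ∀ g ∈ Submodule.span ℂ {g | ∃ x a y b : Fin k → Idx n d, g = coeffFun x a y b},
      Continuous g ∧ ∫ U, f U⁻¹ * g U ∂(haarSym n d) = 0 := by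
    intro g hg
    induction hg using Submodule.span_induction with
    | mem g hg =>
      obtain ⟨x, a, y, b, rfl⟩ := hg
      exact ⟨continuous_coeffFun x a y b, congrFun (congrFun (hzero a b) x) y⟩
    | zero => exact ⟨continuous_const, by simp⟩
    | add g h _ _ hg hh =>
      refine ⟨hg.1.add hh.1, ?_⟩
      simp only [Pi.add_apply, mul_add]
      rw [integral_add, hg.2, hh.2, add_zero]
      · exact integrable_of_continuous ((hf.comp continuous_inv).mul hg.1) _
      · exact integrable_of_continuous ((hf.comp continuous_inv).mul hh.1) _
    | smul z g _ hg =>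
      refine ⟨hg.1.const_smul z, ?_⟩
      simp only [Pi.smul_apply, mul_smul_comm]
      rw [integral_smul, hg.2, smul_zero]
  have h1 : ∀ U : SymU n d, f U⁻¹ * f U = 1 := fun U => by
    rw [← map_mul, inv_mul_cancel, map_one]
  have := (hspan f (mem_span_coeffFun hmem)).2
  simp only [h1] at this
  simp at this

lemma integral_character_eq_zero {n d : ℕ} {f : SymU n d →* ℂ} (hf : ∃ g, f g ≠ 1) :
    ∫ U, f U ∂(haarSym n d) = 0 := by
  obtain ⟨g, hg⟩ := hf
  have h := integral_mul_left_eq_self (μ := haarSym n d) f g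
  simp_rw [map_mul] at h
  rw [integral_const_mul] at h
  have h2 : (f g - 1) * ∫ U, f U ∂(haarSym n d) = 0 := by rw [sub_mul, h, one_mul, sub_self]
  exact (mul_eq_zero.1 h2).resolve_left (sub_ne_zero.2 hg)

/-- A nontrivial character that is trivial on the local group and is a matrix coefficient of
`U^{⊗ k} ⊗ Ū^{⊗ k}` for large `k` rules out designs of large order. -/
lemma noLargeDesigns_of_character {n d γ : ℕ} [Nonempty (Idx n d)] {f : SymU n d →* ℂ}
    (hf : Continuous f) (htriv : ∀ U ∈ localGroup n d γ, f U = 1) (hnt : ∃ g, f g ≠ 1)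
    (hmem : ∃ k₀, ∀ k ≥ k₀, ⇑f ∈ entrySpan n d ^ k * conjEntrySpan n d ^ k) :
    NoLargeDesigns n d γ := by
  obtain ⟨k₀, hk₀⟩ := hmem
  refine ⟨k₀, fun k hk => ?_⟩
  obtain ⟨M, hM, heig⟩ := exists_conjPow_eigenvector hf (hk₀ k hk)
  obtain ⟨δ, hδ, hdiam⟩ := exists_le_diamondNorm hM
  have hd : (0 : ℝ) < ((d : ℝ) ^ n) ^ k := by
    have : 0 < Fintype.card (Idx n d) := Fintype.card_pos
    rw [Fintype.card_fun, Fintype.card_fin, Fintype.card_fin] at this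
    have h' : (0 : ℝ) < (d : ℝ) ^ n := by exact_mod_cast this
    positivity
  -- The factor cancels the normalization in the design condition, leaving `δ ≤ δ / 2`.
  refine ⟨δ / 2 * ((d : ℝ) ^ n) ^ k, by positivity, fun ν _ hν s hdes => ?_⟩
  have hT : twirl ν k M = M := by
    ext x y
    have : ∀ᵐ U ∂ν, conjPow k U M x y = M x y := by
      filter_upwards [hν] with U hU
      rw [heig, htriv U hU, one_smul]
    change ∫ U, conjPow k U M x y ∂ν = M x y
    rw [integral_congr_ae this]
    simp
  have hTs : ∀ s : ℕ, (twirl ν k ^ s) M = M := by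
    intro s
    induction s with
    | zero => rfl
    | succ s ih => rw [pow_succ, Module.End.mul_apply, hT, ih]
  have hTH : twirl (haarSym n d) k M = 0 := by
    ext x y
    change ∫ U, conjPow k U M x y ∂(haarSym n d) = 0
    have : ∀ U, conjPow k U M x y = f U * M x y := fun U => by rw [heig]; rfl
    simp_rw [this]
    rw [integral_mul_const, integral_character_eq_zero hnt, zero_mul]
  have hle := hdiam (twirl ν k ^ s - twirl (haarSym n d) k) (by
    rw [LinearMap.sub_apply, hTs, hTH, sub_zero])
  have h := hle.trans hdes
  rw [mul_div_cancel_right₀ _ hd.ne', ENNReal.ofReal_le_ofReal_iff (by positivity)] at h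
  linarith

/-! ### Permutation operators and class sums -/

/-- The matrix of a permutation of the qudits. -/
def permMat {n : ℕ} (d : ℕ) (σ : Equiv.Perm (Fin n)) : Matrix (Idx n d) (Idx n d) ℂ :=
  Matrix.of fun x y => if y = x ∘ σ then 1 else 0

lemma permMat_mul_apply {n d : ℕ} (σ : Equiv.Perm (Fin n)) (A : Matrix (Idx n d) (Idx n d) ℂ)
    (x y : Idx n d) : (permMat d σ * A) x y = A (x ∘ σ) y := by
  simp [permMat, Matrix.mul_apply]

lemma mul_permMat_apply {n d : ℕ} (σ : Equiv.Perm (Fin n)) (A : Matrix (Idx n d) (Idx n d) ℂ)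
    (x y : Idx n d) : (A * permMat d σ) x y = A x (y ∘ σ.symm) := by
  rw [Matrix.mul_apply, Finset.sum_eq_single (y ∘ σ.symm)]
  · rw [permMat, Matrix.of_apply, if_pos (by ext i; simp), mul_one]
  · intro z _ hz
    rw [permMat, Matrix.of_apply, if_neg, mul_zero]
    rintro rfl
    exact hz (by ext i; simp)
  · simp

lemma permMat_mulVec {n d : ℕ} (σ : Equiv.Perm (Fin n)) (v : Idx n d → ℂ) :
    permMat d σ *ᵥ v = permRep n d σ v := by
  ext x
  change ∑ y, (if y = x ∘ σ then (1 : ℂ) else 0) * v y = v (x ∘ σ)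
  simp

lemma conjTranspose_permMat {n d : ℕ} (σ : Equiv.Perm (Fin n)) :
    (permMat d σ)ᴴ = permMat d σ⁻¹ := by
  ext x y
  have : x = y ∘ σ ↔ y = x ∘ ⇑σ⁻¹ := by
    constructor
    · rintro rfl
      ext i
      simp
    · rintro rfl
      ext i
      simp
  simp only [permMat, Matrix.conjTranspose_apply, Matrix.of_apply, this]
  split_ifs <;> simp

lemma permMat_mul {n d : ℕ} (σ τ : Equiv.Perm (Fin n)) :
    permMat d σ * permMat d τ = permMat d (σ * τ) := by
  ext x y
  rw [permMat_mul_apply]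
  rfl

lemma commute_permMat_iff {n d : ℕ} (σ : Equiv.Perm (Fin n)) (A : Matrix (Idx n d) (Idx n d) ℂ) :
    Commute (permMat d σ) A ↔ ∀ x y, A (x ∘ σ) (y ∘ σ) = A x y := by
  constructor
  · intro h x y
    have := congrFun (congrFun h.eq x) (y ∘ σ)
    rw [permMat_mul_apply, mul_permMat_apply] at this
    rw [this]
    congr 1
    ext i
    simp
  · intro h
    ext x y
    rw [permMat_mul_apply, mul_permMat_apply, ← h x (y ∘ σ.symm)]
    congr 1
    ext i
    simp

lemma commute_permMat_tensorPow {n d : ℕ} (σ : Equiv.Perm (Fin n)) (V : Matrix (Fin d) (Fin d) ℂ) :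
    Commute (permMat d σ) (tensorPow n V) := by
  rw [commute_permMat_iff]
  intro x y
  exact Equiv.prod_comp σ fun i => V (x i) (y i)

/-- The Hermitian sum of the conjugates of a permutation and its inverse. -/
def classSum {n : ℕ} (d : ℕ) (σ : Equiv.Perm (Fin n)) : Matrix (Idx n d) (Idx n d) ℂ :=
  ∑ g : Equiv.Perm (Fin n), (permMat d (g * σ * g⁻¹) + permMat d (g * σ⁻¹ * g⁻¹))

lemma isHermitian_classSum {n d : ℕ} (σ : Equiv.Perm (Fin n)) : (classSum d σ).IsHermitian := by
  rw [Matrix.IsHermitian, classSum, Matrix.conjTranspose_sum]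
  refine Finset.sum_congr rfl fun g _ => ?_
  rw [Matrix.conjTranspose_add, conjTranspose_permMat, conjTranspose_permMat, add_comm]
  congr 2

lemma isSymmetric_classSum {n d : ℕ} (σ : Equiv.Perm (Fin n)) : IsSymmetric (classSum d σ) :=
  fun V _ => Commute.sum_left _ _ _ fun _ _ =>
    (commute_permMat_tensorPow _ V).add_left (commute_permMat_tensorPow _ V)

lemma commute_permMat_classSum {n d : ℕ} (σ τ : Equiv.Perm (Fin n)) :
    Commute (permMat d τ) (classSum d σ) := by
  rw [Commute, SemiconjBy, classSum, Finset.mul_sum, Finset.sum_mul]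
  refine Fintype.sum_equiv (Equiv.mulLeft τ) _ _ fun g => ?_
  simp only [mul_add, add_mul, permMat_mul, Equiv.coe_mulLeft]
  congr 2 <;> group

/-- The diagonal of a permutation matrix marks its fixed words. Conjugation preserves word classes,
and `σ` and `σ⁻¹` fix the same words, so all `2 * n!` terms agree. -/
lemma sum_weight_mul_classSum {n d : ℕ} (m : WordClass n d → ℤ) (σ : Equiv.Perm (Fin n)) :
    ∑ x, (m (cls x) : ℂ) * classSum d σ x x = 2 * (Fintype.card (Equiv.Perm (Fin n)) : ℂ) *
      ((∑ x : Idx n d, if x ∘ σ = x then m (cls x) else 0 : ℤ) : ℂ) := by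
  set r : ℤ := ∑ x : Idx n d, if x ∘ σ = x then m (cls x) else 0 with hr
  have h1 : ∀ τ g : Equiv.Perm (Fin n), (∀ x : Idx n d, x ∘ τ = x ↔ x ∘ σ = x) →
      ∑ x, (m (cls x) : ℂ) * permMat d (g * τ * g⁻¹) x x = r := by
    intro τ g hτ
    rw [hr, Int.cast_sum]
    refine Fintype.sum_equiv (Equiv.arrowCongr g.symm (Equiv.refl (Fin d))) _ _ fun x => ?_
    have e : (Equiv.arrowCongr g.symm (Equiv.refl (Fin d))) x = x ∘ g := rfl
    have hc : cls (x ∘ g) = cls x := cls_comp x 1 g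
    have hiff : x = x ∘ ⇑(g * τ * g⁻¹) ↔ (x ∘ g) ∘ σ = x ∘ g := by
      rw [← hτ]
      constructor
      · intro h
        ext i
        have := congrFun h (g i)
        simp only [Function.comp_apply, Equiv.Perm.mul_apply, Equiv.Perm.inv_def,
          Equiv.symm_apply_apply] at this
        simp [← this]
      · intro h
        ext i
        have := congrFun h (g.symm i)
        simp only [Function.comp_apply, Equiv.apply_symm_apply] at this
        simp [this]
    rw [e, hc, permMat, Matrix.of_apply]
    simp only [hiff]
    split_ifs <;> simp
  have hinv : ∀ x : Idx n d, x ∘ ⇑σ⁻¹ = x ↔ x ∘ σ = x := by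
    intro x
    constructor
    · intro h
      conv_lhs => rw [← h]
      ext i
      simp
    · intro h
      conv_lhs => rw [← h]
      ext i
      simp
  simp_rw [classSum, Matrix.sum_apply, Matrix.add_apply, Finset.mul_sum]
  rw [Finset.sum_comm]
  simp_rw [mul_add, Finset.sum_add_distrib, h1 σ _ fun x => Iff.rfl, h1 σ⁻¹ _ hinv]
  simp
  ring

/-! ### Time evolution under a symmetric Hamiltonian -/

lemma exp_mem_unitaryGroup {ι : Type*} [Fintype ι] [DecidableEq ι] {H : Matrix ι ι ℂ}
    (hH : H.IsHermitian) :
    NormedSpace.exp ((-Complex.I) • H) ∈ Matrix.unitaryGroup ι ℂ := by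
  rw [Matrix.mem_unitaryGroup_iff, Matrix.star_eq_conjTranspose, ← Matrix.exp_conjTranspose,
    Matrix.conjTranspose_smul, hH.eq, ← Matrix.exp_add_of_commute]
  · simp
  · exact ((Commute.refl H).smul_left _).smul_right _

/-- The symmetric unitary `e^{-iH}`. -/
def timeEvolution {n d : ℕ} {H : Matrix (Idx n d) (Idx n d) ℂ} (hH : H.IsHermitian)
    (hs : IsSymmetric H) : SymU n d :=
  ⟨⟨NormedSpace.exp ((-Complex.I) • H), exp_mem_unitaryGroup hH⟩,
    fun V hV => ((hs V hV).smul_left _).exp_left⟩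

open scoped Matrix.Norms.Operator in
lemma exp_mulVec_of_eigenvector {ι : Type*} [Fintype ι] [DecidableEq ι] {A : Matrix ι ι ℂ}
    {v : ι → ℂ} {a : ℂ} (h : A *ᵥ v = a • v) :
    NormedSpace.exp A *ᵥ v = Complex.exp a • v := by
  -- Repeating `v` in every column turns the eigenvector equation into an intertwining relation,
  -- which passes to exponentials.
  let Y : Matrix ι ι ℂ := Matrix.of fun x _ => v x
  have hY : SemiconjBy Y (Matrix.diagonal fun _ => a) A := by
    ext x y
    rw [Matrix.mul_diagonal]
    have := congrFun h x
    simp only [Matrix.mulVec, dotProduct, Pi.smul_apply, smul_eq_mul] at this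
    rw [Matrix.mul_apply]
    simp only [Y, Matrix.of_apply]
    rw [this, mul_comm]
  have h1 : Y * NormedSpace.exp (Matrix.diagonal fun _ => a) = NormedSpace.exp A * Y :=
    hY.exp_right.eq
  ext x
  have h2 := congrFun (congrFun h1 x) x
  rw [Matrix.exp_diagonal, Matrix.mul_diagonal, Pi.coe_exp, ← Complex.exp_eq_exp_ℂ,
    Matrix.mul_apply] at h2
  simp only [Y, Matrix.of_apply] at h2
  simp only [Matrix.mulVec, dotProduct, Pi.smul_apply, smul_eq_mul]
  rw [← h2, mul_comm]

/-! ### Schur's lemma on the charge sectors -/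

/-- The endomorphism of the `S_n`-module of `n` qudits given by a matrix that commutes with the
permutations. -/
def toModuleEnd {n d : ℕ} (A : Matrix (Idx n d) (Idx n d) ℂ)
    (hA : ∀ σ : Equiv.Perm (Fin n), Commute (permMat d σ) A) :
    Module.End (MonoidAlgebra ℂ (Equiv.Perm (Fin n))) (permRep n d).asModule :=
  Representation.IntertwiningMap.equivAlgEnd (permRep n d)
    { toLinearMap := Matrix.toLin' A
      isIntertwining' := fun σ => by
        refine LinearMap.ext fun v => ?_
        simp only [LinearMap.comp_apply, Matrix.toLin'_apply, ← permMat_mulVec,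
          Matrix.mulVec_mulVec, (hA σ).eq] }

lemma asModuleEquiv_toModuleEnd {n d : ℕ} (A : Matrix (Idx n d) (Idx n d) ℂ)
    (hA : ∀ σ : Equiv.Perm (Fin n), Commute (permMat d σ) A) (v : (permRep n d).asModule) :
    (permRep n d).asModuleEquiv (toModuleEnd A hA v) = A *ᵥ (permRep n d).asModuleEquiv v :=
  rfl

lemma exists_smul_eq_classSum {n : ℕ} (d : ℕ) (σ : Equiv.Perm (Fin n)) :
    ∃ z : MonoidAlgebra ℂ (Equiv.Perm (Fin n)), ∀ v : (permRep n d).asModule,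
      toModuleEnd (classSum d σ) (commute_permMat_classSum σ) v = z • v := by
  refine ⟨∑ g : Equiv.Perm (Fin n), (MonoidAlgebra.of ℂ _ (g * σ * g⁻¹) +
    MonoidAlgebra.of ℂ _ (g * σ⁻¹ * g⁻¹)), fun v => ?_⟩
  apply (permRep n d).asModuleEquiv.injective
  rw [asModuleEquiv_toModuleEnd, Representation.asModuleEquiv_map_smul, map_sum, classSum,
    Matrix.sum_mulVec, LinearMap.sum_apply]
  refine Finset.sum_congr rfl fun g _ => ?_
  rw [Matrix.add_mulVec, map_add, LinearMap.add_apply, Representation.asAlgebraHom_of,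
    Representation.asAlgebraHom_of, permMat_mulVec, permMat_mulVec]

/-- Schur's lemma gives a scalar on one irreducible `S`. The class sum acts through a group algebra
element, so isomorphic copies share that scalar. -/
lemma classSum_mulVec_of_mem_sector {n d : ℕ} (σ : Equiv.Perm (Fin n))
    {C : Submodule (MonoidAlgebra ℂ (Equiv.Perm (Fin n))) (permRep n d).asModule}
    (hC : C ∈ sectors n d) : ∃ κ : ℂ, ∀ v ∈ C,
      classSum d σ *ᵥ (permRep n d).asModuleEquiv v = κ • (permRep n d).asModuleEquiv v := by
  obtain ⟨S, hS, rfl⟩ := hC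
  obtain ⟨z, hz⟩ := exists_smul_eq_classSum d σ
  set φ := toModuleEnd (classSum d σ) (commute_permMat_classSum σ)
  have : FiniteDimensional ℂ S :=
    FiniteDimensional.finiteDimensional_submodule (S.restrictScalars ℂ)
  let ψ : Module.End (MonoidAlgebra ℂ (Equiv.Perm (Fin n))) S :=
    φ.restrict fun s hs => by rw [hz]; exact S.smul_mem z hs
  obtain ⟨κ, hκ⟩ := (IsSimpleModule.algebraMap_end_bijective_of_isAlgClosed ℂ
    (A := MonoidAlgebra ℂ (Equiv.Perm (Fin n))) (V := S)).2 ψ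
  have hS' : ∀ s : S, z • s = κ • s := fun s => by
    have h1 : κ • s = ψ s := congrArg (fun f => f s) hκ
    rw [h1]
    exact Subtype.ext (hz s).symm
  have hle : isotypicComponent (MonoidAlgebra ℂ (Equiv.Perm (Fin n))) (permRep n d).asModule S ≤
      LinearMap.ker (φ - algebraMap ℂ (Module.End (MonoidAlgebra ℂ (Equiv.Perm (Fin n)))
        (permRep n d).asModule) κ) := by
    refine sSup_le fun N hN v hv => ?_
    obtain ⟨e⟩ := hN
    have h1 : z • (⟨v, hv⟩ : N) = κ • (⟨v, hv⟩ : N) := by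
      apply e.injective
      rw [map_smul, hS']
      exact (LinearMap.map_smul_of_tower e.toLinearMap κ _).symm
    rw [LinearMap.mem_ker, LinearMap.sub_apply, hz, sub_eq_zero]
    exact congrArg Subtype.val h1
  refine ⟨κ, fun v hv => ?_⟩
  have h := hle hv
  rw [LinearMap.mem_ker, LinearMap.sub_apply, sub_eq_zero] at h
  exact congrArg (permRep n d).asModuleEquiv h

/-- For every nonzero weight some relative phase matrix has a nontrivial character value. -/
lemma exists_relativePhase_weightHom_ne_one {n d : ℕ} {m : WordClass n d → ℤ} (hm : m ≠ 0) :
    ∃ U : SymU n d, IsRelativePhase U ∧ weightHom m U ≠ 1 := by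
  obtain ⟨σ, hσ⟩ := exists_perm_sum_fixed_ne_zero hm
  set r : ℤ := ∑ x : Idx n d, if x ∘ σ = x then m (cls x) else 0 with hr
  let R : ℝ := 2 * Fintype.card (Equiv.Perm (Fin n)) * r
  have hR : R ≠ 0 := mul_ne_zero (mul_ne_zero two_ne_zero
    (Nat.cast_ne_zero.2 Fintype.card_ne_zero)) (Int.cast_ne_zero.2 hσ)
  -- The evolution time is tuned so that the character takes the value `exp(-iπ) = -1`.
  let t : ℝ := Real.pi / R
  have hH : ((t : ℂ) • classSum d σ).IsHermitian := by
    rw [Matrix.IsHermitian, Matrix.conjTranspose_smul, (isHermitian_classSum σ).eq,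
      RCLike.star_def, Complex.conj_ofReal]
  have hs : IsSymmetric ((t : ℂ) • classSum d σ) := fun V hV =>
    (isSymmetric_classSum σ V hV).smul_left _
  refine ⟨timeEvolution hH hs, fun C hC => ?_, ?_⟩
  · obtain ⟨κ, hκ⟩ := classSum_mulVec_of_mem_sector σ hC
    refine ⟨Complex.exp (-Complex.I * (t * κ)), fun v hv => exp_mulVec_of_eigenvector ?_⟩
    rw [Matrix.smul_mulVec, Matrix.smul_mulVec, hκ v hv, smul_smul, smul_smul, mul_assoc]
  · change weightChar m (NormedSpace.exp ((-Complex.I) • ((t : ℂ) • classSum d σ))) ≠ 1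
    rw [weightChar_exp m hH hs.commute_classProj]
    have h1 : ∑ x, (m (cls x) : ℂ) * ((t : ℂ) • classSum d σ) x x = Real.pi := by
      have : ∀ x, (m (cls x) : ℂ) * ((t : ℂ) • classSum d σ) x x =
          t * ((m (cls x) : ℂ) * classSum d σ x x) := fun x => by
        rw [Matrix.smul_apply, smul_eq_mul]; ring
      simp_rw [this]
      rw [← Finset.mul_sum, sum_weight_mul_classSum, ← hr]
      have hR' : t * R = Real.pi := div_mul_cancel₀ _ hR
      rw [← hR']
      simp only [R]
      push_cast
      ring
    rw [h1]
    have h2 : Complex.exp (-Complex.I * Real.pi) = -1 := by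
      rw [neg_mul, Complex.exp_neg, mul_comm, Complex.exp_pi_mul_I]
      norm_num
    rw [h2]
    norm_num

/-! ### Polarization -/

/-- The trace is a polynomial in the entries of `V`. Its monomials correspond to orbits of position
permutations on index pairs, and `Z` is constant on orbits, so each coefficient is an orbit size
times an entry of `Z`. -/
lemma eq_zero_of_trace_mul_tensorPow {n d : ℕ} {Z : Matrix (Idx n d) (Idx n d) ℂ}
    (hZ : ∀ (σ : Equiv.Perm (Fin n)) x y, Z (x ∘ σ) (y ∘ σ) = Z x y)
    (h : ∀ V : Matrix (Fin d) (Fin d) ℂ, (Z * tensorPow n V).trace = 0) : Z = 0 := by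
  classical
  let key : Idx n d × Idx n d → (Fin d × Fin d →₀ ℕ) := fun p =>
    ∑ i, Finsupp.single (p.2 i, p.1 i) 1
  let Q : MvPolynomial (Fin d × Fin d) ℂ := ∑ p : Idx n d × Idx n d,
    MvPolynomial.monomial (key p) (Z p.1 p.2)
  have hQ : Q = 0 := by
    refine MvPolynomial.funext fun v => ?_
    rw [map_zero, ← h (Matrix.of fun i j => v (i, j)), Matrix.trace]
    simp only [Q, Matrix.diag_apply, Matrix.mul_apply, map_sum, MvPolynomial.eval_monomial]
    rw [Fintype.sum_prod_type]
    refine Finset.sum_congr rfl fun x _ => Finset.sum_congr rfl fun y _ => ?_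
    congr 1
    simp only [key, tensorPow, Matrix.of_apply]
    rw [← Finsupp.prod_finsetSum_index (by simp) (by intros; rw [pow_add])]
    simp
  have hkey : ∀ p q, key p = key q → Z p.1 p.2 = Z q.1 q.2 := by
    intro p q hpq
    obtain ⟨σ, hσ⟩ := exists_perm_comp_eq (fun i => (p.2 i, p.1 i)) (fun i => (q.2 i, q.1 i)) <| by
      intro b
      have := congrArg (fun f => f b) hpq
      simp only [key, Finsupp.finsetSum_apply, Finsupp.single_apply, Finset.sum_boole,
        Nat.cast_id] at this
      simpa only [Fintype.card_subtype] using this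
    have h1 : p.2 = q.2 ∘ σ := funext fun i => congrArg Prod.fst (congrFun hσ i).symm
    have h2 : p.1 = q.1 ∘ σ := funext fun i => congrArg Prod.snd (congrFun hσ i).symm
    rw [h1, h2, hZ]
  ext x y
  have hc : MvPolynomial.coeff (key (x, y)) Q = 0 := by rw [hQ, MvPolynomial.coeff_zero]
  simp only [Q, MvPolynomial.coeff_sum, MvPolynomial.coeff_monomial] at hc
  have he : ∀ p : Idx n d × Idx n d, (if key p = key (x, y) then Z p.1 p.2 else 0) =
      if key p = key (x, y) then Z x y else 0 := by
    intro p
    split_ifs with hp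
    · exact hkey _ _ hp
    · rfl
  simp_rw [he] at hc
  rw [← Finset.sum_filter, Finset.sum_const, nsmul_eq_mul, mul_eq_zero] at hc
  exact hc.resolve_left (Nat.cast_ne_zero.2 (Finset.card_ne_zero.2 ⟨(x, y), by simp⟩))

/-- Write `V = X + iY` with `X`, `Y` Hermitian. The trace at `X + tY` is polynomial in `t` and
vanishes for real `t`, hence at `t = i`. -/
lemma trace_mul_tensorPow_eq_zero_of_isHermitian {n d : ℕ} {Z : Matrix (Idx n d) (Idx n d) ℂ}
    (h : ∀ V : Matrix (Fin d) (Fin d) ℂ, V.IsHermitian → (Z * tensorPow n V).trace = 0)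
    (V : Matrix (Fin d) (Fin d) ℂ) : (Z * tensorPow n V).trace = 0 := by
  let X : Matrix (Fin d) (Fin d) ℂ := (1 / 2 : ℂ) • (V + Vᴴ)
  let Y : Matrix (Fin d) (Fin d) ℂ := (-Complex.I / 2 : ℂ) • (V - Vᴴ)
  have hX : X.IsHermitian := by
    simp only [Matrix.IsHermitian, X, Matrix.conjTranspose_smul, Matrix.conjTranspose_add,
      Matrix.conjTranspose_conjTranspose, add_comm]
    simp
  have hY : Y.IsHermitian := by
    simp only [Matrix.IsHermitian, Y, Matrix.conjTranspose_smul, Matrix.conjTranspose_sub,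
      Matrix.conjTranspose_conjTranspose]
    rw [← neg_sub V, smul_neg, ← neg_smul]
    congr 1
    simp [neg_div]
  have hV : V = X + Complex.I • Y := by
    simp only [X, Y, smul_smul]
    ext i j
    simp only [Matrix.add_apply, Matrix.smul_apply, Matrix.sub_apply, smul_eq_mul]
    linear_combination ((V i j - Vᴴ i j) / 2) * Complex.I_mul_I
  let p : Polynomial ℂ := ∑ x : Idx n d, ∑ y : Idx n d, Polynomial.C (Z x y) *
    ∏ i, (Polynomial.C (X (y i) (x i)) + Polynomial.X * Polynomial.C (Y (y i) (x i)))
  have hp : ∀ t : ℂ, p.eval t = (Z * tensorPow n (X + t • Y)).trace := by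
    intro t
    simp [p, Matrix.trace, Matrix.mul_apply, tensorPow, Polynomial.eval_finsetSum,
      Polynomial.eval_prod, mul_comm t]
  have hp0 : p = 0 := by
    refine Polynomial.eq_zero_of_infinite_isRoot p ?_
    refine Set.Infinite.mono (s := Set.range ((↑) : ℝ → ℂ)) ?_
      (Set.infinite_range_of_injective Complex.ofReal_injective)
    rintro _ ⟨t, rfl⟩
    change p.eval (t : ℂ) = 0
    rw [hp]
    refine h _ (hX.add ?_)
    rw [Matrix.IsHermitian, Matrix.conjTranspose_smul, hY.eq, RCLike.star_def,
      Complex.conj_ofReal]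
  have := hp Complex.I
  rw [hp0, Polynomial.eval_zero] at this
  rw [hV, ← this]

lemma tensorPow_one {d : ℕ} (n : ℕ) : tensorPow n (1 : Matrix (Fin d) (Fin d) ℂ) = 1 := by
  rw [← Matrix.diagonal_one, tensorPow_diagonal]
  simp

/-- An operator in the center of the commutant of the permutations is determined by its
diagonal. -/
lemma eq_zero_of_diag_eq_zero {n d : ℕ} {Z : Matrix (Idx n d) (Idx n d) ℂ}
    (hZ : ∀ σ : Equiv.Perm (Fin n), Commute (permMat d σ) Z)
    (hZV : ∀ V : Matrix (Fin d) (Fin d) ℂ, Commute Z (tensorPow n V))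
    (hdiag : ∀ x, Z x x = 0) : Z = 0 := by
  refine eq_zero_of_trace_mul_tensorPow (fun σ => (commute_permMat_iff σ Z).1 (hZ σ))
    (trace_mul_tensorPow_eq_zero_of_isHermitian fun V hV => ?_)
  have hs := hV.spectral_theorem
  rw [Unitary.conjStarAlgAut_apply] at hs
  set W : Matrix (Fin d) (Fin d) ℂ := (hV.eigenvectorUnitary : Matrix (Fin d) (Fin d) ℂ)
  have hW : star W * W = 1 := Unitary.coe_star_mul_self hV.eigenvectorUnitary
  -- As `Z` commutes with the tensor power of the eigenbasis `W`, the trace reduces to a diagonal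
  -- `V` and sees only the diagonal of `Z`.
  rw [hs, tensorPow_mul, tensorPow_mul, ← mul_assoc, Matrix.trace_mul_comm, ← mul_assoc,
    ← mul_assoc, ← (hZV _).eq, mul_assoc Z, ← tensorPow_mul, hW, tensorPow_one, mul_one,
    tensorPow_diagonal, Matrix.trace]
  simp [Matrix.mul_diagonal, hdiag]

/-! ### The number of charge sectors -/

/-- The matrix of an endomorphism of the `S_n`-module of `n` qudits. -/
def endMat (n d : ℕ) :
    Module.End (MonoidAlgebra ℂ (Equiv.Perm (Fin n))) (permRep n d).asModule →ₗ[ℂ]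
      Matrix (Idx n d) (Idx n d) ℂ where
  toFun φ := LinearMap.toMatrix'
    ((Representation.IntertwiningMap.equivAlgEnd (permRep n d)).symm φ).toLinearMap
  map_add' φ ψ := by simp
  map_smul' a φ := by simp

lemma endMat_mulVec {n d : ℕ}
    (φ : Module.End (MonoidAlgebra ℂ (Equiv.Perm (Fin n))) (permRep n d).asModule)
    (v : (permRep n d).asModule) :
    endMat n d φ *ᵥ (permRep n d).asModuleEquiv v = (permRep n d).asModuleEquiv (φ v) := by
  rw [endMat, LinearMap.coe_mk, AddHom.coe_mk, LinearMap.toMatrix'_mulVec]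
  rfl

lemma endMat_injective {n d : ℕ} : Function.Injective (endMat n d) := by
  intro φ ψ h
  refine LinearMap.ext fun v => (permRep n d).asModuleEquiv.injective ?_
  rw [← endMat_mulVec, ← endMat_mulVec, h]

lemma commute_endMat {n d : ℕ}
    {φ : Module.End (MonoidAlgebra ℂ (Equiv.Perm (Fin n))) (permRep n d).asModule}
    {A : Matrix (Idx n d) (Idx n d) ℂ} (hA : ∀ σ : Equiv.Perm (Fin n), Commute (permMat d σ) A)
    (h : Commute φ (toModuleEnd A hA)) : Commute (endMat n d φ) A := by
  refine Matrix.mulVec_injective (funext fun v => ?_)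
  obtain ⟨w, rfl⟩ := (permRep n d).asModuleEquiv.surjective v
  rw [← Matrix.mulVec_mulVec, ← Matrix.mulVec_mulVec, endMat_mulVec,
    ← asModuleEquiv_toModuleEnd A hA, endMat_mulVec, ← asModuleEquiv_toModuleEnd A hA]
  exact congrArg _ (congrArg (fun f => f w) h.eq)

lemma commute_permMat_endMat {n d : ℕ}
    (φ : Module.End (MonoidAlgebra ℂ (Equiv.Perm (Fin n))) (permRep n d).asModule)
    (σ : Equiv.Perm (Fin n)) : Commute (permMat d σ) (endMat n d φ) := by
  refine Matrix.mulVec_injective (funext fun v => ?_)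
  obtain ⟨w, rfl⟩ := (permRep n d).asModuleEquiv.surjective v
  have h : ∀ u, permMat d σ *ᵥ (permRep n d).asModuleEquiv u =
      (permRep n d).asModuleEquiv (MonoidAlgebra.of ℂ _ σ • u) := fun u => by
    rw [permMat_mulVec, Representation.asModuleEquiv_map_smul, Representation.asAlgebraHom_of]
  rw [← Matrix.mulVec_mulVec, ← Matrix.mulVec_mulVec, endMat_mulVec, h, h, endMat_mulVec,
    LinearMap.map_smul]

lemma apply_letterPerm {n d : ℕ} {Z : Matrix (Idx n d) (Idx n d) ℂ}
    (hZV : ∀ V : Matrix (Fin d) (Fin d) ℂ, Commute Z (tensorPow n V))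
    (π : Equiv.Perm (Fin d)) (x y : Idx n d) : Z (π ∘ x) (π ∘ y) = Z x y := by
  let P : Matrix (Fin d) (Fin d) ℂ := Matrix.of fun i j => if j = π i then 1 else 0
  have hP : ∀ a b : Idx n d, tensorPow n P a b = if b = π ∘ a then 1 else 0 := by
    intro a b
    simp only [tensorPow, P, Matrix.of_apply]
    rw [Finset.prod_boole]
    simp [funext_iff]
  have h := congrFun (congrFun (hZV P).eq x) (π ∘ y)
  rw [Matrix.mul_apply, Matrix.mul_apply] at h
  have hinj : ∀ a : Idx n d, π ∘ y = π ∘ a ↔ a = y := fun a =>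
    ⟨fun h => (π.injective.comp_left h).symm, fun h => by rw [h]⟩
  simp only [hP, hinj] at h
  simpa using h.symm

/-- A choice of one scalar per sector is a central endomorphism. Its matrix is invariant under
permuting positions and letters, so its diagonal is a function on word classes, and that diagonal
determines it. -/
lemma numSectors_le (n d : ℕ) : numSectors n d ≤ Fintype.card (WordClass n d) := by
  classical
  let R := MonoidAlgebra ℂ (Equiv.Perm (Fin n))
  let M := (permRep n d).asModule
  have : IsNoetherian R M := isNoetherian_of_tower ℂ inferInstance
  have : Finite (sectors n d) := inferInstanceAs (Finite (isotypicComponents R M))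
  have := Fintype.ofFinite (sectors n d)
  let e := IsSemisimpleModule.endAlgEquiv ℂ R M
  let s : (sectors n d → ℂ) →ₗ[ℂ] Module.End R M := e.symm.toLinearMap ∘ₗ
    LinearMap.pi fun c : isotypicComponents R M =>
      (Algebra.linearMap ℂ (Module.End R c.1)) ∘ₗ LinearMap.proj c
  have hes : ∀ z c, e (s z) c = algebraMap ℂ (Module.End R c.1) (z c) := by
    intro z c
    exact congrFun (e.apply_symm_apply _) c
  have hcomm : ∀ z φ, Commute (s z) φ := by
    intro z φ
    apply e.injective
    funext c
    rw [map_mul, map_mul, Pi.mul_apply, Pi.mul_apply, hes]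
    exact Algebra.commutes _ _
  choose r hr using cls_surjective (n := n) (d := d)
  let L : (sectors n d → ℂ) →ₗ[ℂ] (WordClass n d → ℂ) := LinearMap.pi fun c =>
    (Matrix.entryLinearMap ℂ ℂ (r c) (r c)) ∘ₗ endMat n d ∘ₗ s
  have hL : Function.Injective L := by
    rw [← LinearMap.ker_eq_bot, Submodule.eq_bot_iff]
    intro z hz
    have hz' : ∀ c, endMat n d (s z) (r c) (r c) = 0 := fun c => congrFun hz c
    have hV : ∀ V : Matrix (Fin d) (Fin d) ℂ, Commute (endMat n d (s z)) (tensorPow n V) :=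
      fun V => commute_endMat (fun σ => commute_permMat_tensorPow σ V) (hcomm z _)
    have hdiag : ∀ x, endMat n d (s z) x x = 0 := by
      intro x
      obtain ⟨π, σ, hx⟩ := cls_eq_cls.1 (hr (cls x))
      conv_lhs => rw [hx]
      rw [apply_letterPerm hV, (commute_permMat_iff σ _).1 (commute_permMat_endMat _ σ), hz']
    have h0 : s z = 0 := endMat_injective <| by
      rw [map_zero]
      exact eq_zero_of_diag_eq_zero (commute_permMat_endMat _) hV hdiag
    funext c
    have h1 : 0 = algebraMap ℂ (Module.End R c.1) (z c) := by
      rw [← hes z c, h0, map_zero]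
      rfl
    have hnt : Nontrivial c.1 :=
      Submodule.nontrivial_iff_ne_bot.2 (bot_lt_isotypicComponents c.2).ne'
    exact (FaithfulSMul.algebraMap_injective ℂ (Module.End R c.1)) (h1.symm.trans (map_zero _).symm)
  have := card_le_of_injective ℂ L hL
  rwa [← Nat.card_eq_fintype_card, Nat.card_coe_set_eq] at this

/-! ### Combining the bounds -/

lemma exists_separating_weight {n d γ : ℕ}
    (h : 2 ^ γ < Fintype.card (WordClass n d)) :
    ∃ m : WordClass n d → ℤ, m ≠ 0 ∧ (∀ U ∈ localGroup n d γ, weightHom m U = 1) ∧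
      ∑ x : Idx n d, m (cls x) = 0 := by
  have hγ : γ ≤ n := by
    by_contra hlt
    exact absurd (h.trans_le (card_wordClass_le n d))
      (not_lt.2 (Nat.pow_le_pow_right two_pos (by omega)))
  obtain ⟨m, hm0, hm⟩ := exists_weight hγ ((card_wordClass_le γ d).trans_lt h)
  refine ⟨m, hm0, fun U hU => weightHom_eq_one hγ hm hU, ?_⟩
  -- Testing the marginal against the constant function gives total weight zero.
  have := hm (Fin.castLEEmb hγ) fun _ => 1
  simp only [mul_one] at this
  exact_mod_cast this

lemma noLargeDesigns_of_two_pow_lt {n d γ : ℕ}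
    (h : 2 ^ γ < Fintype.card (WordClass n d)) : NoLargeDesigns n d γ := by
  obtain ⟨m, hm0, htriv, hsum⟩ := exists_separating_weight h
  have : Nonempty (Idx n d) := by
    obtain ⟨c, -⟩ := Function.ne_iff.1 hm0
    exact ⟨(cls_surjective c).choose⟩
  obtain ⟨g, -, hg⟩ := exists_relativePhase_weightHom_ne_one hm0
  exact noLargeDesigns_of_character (continuous_weightHom m) htriv ⟨g, hg⟩
    (exists_weightHom_mem hsum)

lemma two_pow_lt_card_wordClass {n d γ : ℕ}
    (h : (γ : ℝ) < 1 * Real.log (numSectors n d)) : 2 ^ γ < Fintype.card (WordClass n d) := by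
  refine lt_of_lt_of_le ?_ (numSectors_le n d)
  have hp : (0 : ℝ) < numSectors n d := by
    rcases Nat.eq_zero_or_pos (numSectors n d) with h0 | h0
    · rw [h0, Nat.cast_zero, Real.log_zero, mul_zero] at h
      exact absurd h (not_lt.2 (Nat.cast_nonneg γ))
    · exact_mod_cast h0
  -- Since `log 2 < 1`, the constant `1` suffices to pass from `γ < log p` to `2 ^ γ < p`.
  have h2 : (γ : ℝ) * Real.log 2 ≤ γ :=
    mul_le_of_le_one_right (Nat.cast_nonneg γ) (by linarith [Real.log_two_lt_d9])
  have h3 : Real.log ((2 : ℝ) ^ γ) < Real.log (numSectors n d) := by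
    rw [Real.log_pow]
    linarith
  have h4 := (Real.log_lt_log_iff (by positivity) hp).1 h3
  exact_mod_cast h4

end SymDesign

end

theorem theorem1 :
    (∃ c > (0 : ℝ), ∀ n d γ : ℕ,
      ((∀ U : SymU n d, IsRelativePhase U → U ∈ localGroup n d γ) →
        c * Real.log (numSectors n d) ≤ γ) ∧
      ((γ : ℝ) < c * Real.log (numSectors n d) → NoLargeDesigns n d γ)) ∧
    (∀ d ≥ 2, ∀ γ : ℕ, ∃ n₀ : ℕ, ∀ n ≥ n₀, NoLargeDesigns n d γ) := by
  refine ⟨⟨1, one_pos, fun n d γ => ⟨fun hall => ?_, fun h =>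
    noLargeDesigns_of_two_pow_lt (two_pow_lt_card_wordClass h)⟩⟩, fun d hd γ =>
    -- This length guarantees at least `2 ^ γ + 1` word classes.
    ⟨2 * (2 ^ γ + 1) + 1, fun n hn => noLargeDesigns_of_two_pow_lt (le_card_wordClass hd hn)⟩⟩
  by_contra hlt
  obtain ⟨m, hm0, htriv, -⟩ := exists_separating_weight (two_pow_lt_card_wordClass (not_le.1 hlt))
  obtain ⟨U, hU, hne⟩ := exists_relativePhase_weightHom_ne_one hm0
  exact hne (htriv U (hall U hU))
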